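/- Let $C$ be an Abelian von Neumann algebra with spectrum $\Delta$ (its space of characters). A Banach $C$-bimodule $V$ is \emph{representable} if there are Hilbert spaces $\mathcal K,\mathcal L$ with $*$-representations $\pi:C\to B(\mathcal K)$, $\sigma:C\to B(\mathcal L)$ and an isometric linear map $J:V\to B(\mathcal L,\mathcal K)$ with $J(cv)=\pi(c)J(v)$ and $J(vc)=J(v)\sigma(c)$; it is \emph{normal representable} if $\pi$ and $\sigma$ can be chosen normal (weak* continuous), and \emph{central} if $cv=vc$ for all $c\in C$, $v\in V$. Let $X,Y$ be central normal representable Banach $C$-bimodules. Let $X\overset{\gamma}{\otimes}_C Y$ be the completion (after dividing out the zero space) of the algebraic tensor product $X\otimes_C Y$ in the projective seminorm $\gamma_C(w)=\inf\{\sum_j\|x_j\|\|y_j\| : w=\sum_{j=1}^n x_j\otimes_C y_j\}$; for Banach spaces, $\overset{\gamma}{\otimes}$ denotes the same construction over $\mathbb C$. Let $X\overset{\nu}{\otimes}_C Y$ be the completion of $X\otimes_C Y$ in $\nu_C(w)=\sup\|\phi(w)\|$, the supremum over all $C$-bilinear contractions $\phi$ from $X\times Y$ into normal representable Banach $C$-bimodules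 (that is, $\phi(cx,y)=c\phi(x,y)$, $\phi(xc,y)=\phi(x,cy)$, $\phi(x,yc)=\phi(x,y)c$ and $\|\phi(x,y)\|\le\|x\|\|y\|$). For $t\in\Delta$ let $X(t)=X/[(\ker t)X]$ be the quotient by the closed linear span of $(\ker t)X$, and $x(t)$ the class of $x$. For Banach spaces $(E_t)_{t\in\Delta}$ let $\mathrm{ess}\oplus_{t\in\Delta} E_t$ be the quotient of their $\ell_\infty$-direct sum by the zero space of the seminorm $(z_t)\mapsto\inf\{c : \{t:\|z_t\|>c\}\text{ is meager}\}$, with the induced norm. Then: (i) $X\overset{\nu}{\otimes}_C Y$ is the normal part of the representable $C$-bimodule $Z=X\overset{\gamma}{\otimes}_C Y$: it is a normal representable $C$-bimodule, there is a contractive $C$-bimodule map $\iota:Z\to X\overset{\nu}{\otimes}_C Y$ with $\iota(x\otimes_C y)=x\otimes_C y$, and for every normal representable Banach $C$-bimodule $V$ and every bounded $C$-bimodule map $T:Z\to V$ there is a unique bounded $C$-bimodule map $T':X\overset{\nu}{\otimes}_C Y\to V$ with $T'\iota=T$, and it satisfies $\|T'\|\le\|T\|$. Moreover, the canonical map $$X\overset{\nu}{\otimes}_C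 Y\to\mathrm{ess}\oplus_{t\in\Delta}\bigl(X(t)\overset{\gamma}{\otimes}Y(t)\bigr),\qquad x\otimes_C y\mapsto\bigl(x(t)\otimes y(t)\bigr)_{t\in\Delta},$$ is a well-defined linear isometry. (ii) For all $x_j\in X$, $y_j\in Y$, $\nu_C\bigl(\sum_{j=1}^n x_j\otimes_C y_j\bigr)=\sup\bigl\|\sum_{j=1}^n\theta(x_j,y_j)\bigr\|$, the supremum over all $C$-bilinear contractions $\theta:X\times Y\to C$. (iii) For all $x_j\in X$, $y_j\in Y$, $\nu_C\bigl(\sum_{j=1}^n x_j\otimes_C y_j\bigr)=\sup\bigl|\sum_{j=1}^n\theta(x_j,y_j)\bigr|$, the supremum over all $\mathbb C$-bilinear contractions $\theta:X\times Y\to\mathbb C$ that are $C$-balanced ($\theta(xc,y)=\theta(x,cy)$) and such that $c\mapsto\theta(x,cy)$ is weak* continuous on $C$ for all $x\in X$, $y\in Y$. -/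

import Mathlib

open scoped TensorProduct InnerProductSpace ENNReal Topology
open MulOpposite UniformSpace WeakDual

universe u

noncomputable section

set_option linter.unusedSectionVars false

namespace CentralModule

/-! ### Von Neumann algebras and their weak* topology -/

section VonNeumann

/-- The ultraweak (`σ`-weak, weak*) topology of `B(H)`: the coarsest topology for which all the
functionals `T ↦ ∑ₙ ⟪ηₙ, T ξₙ⟫`, with `(ξₙ)` and `(ηₙ)` square-summable, are continuous. -/
@[reducible]
def ultraweak (H : Type u) [NormedAddCommGroup H] [InnerProductSpace ℂ H] :
    TopologicalSpace (H →L[ℂ] H) :=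
  ⨅ p : lp (fun _ : ℕ => H) 2 × lp (fun _ : ℕ => H) 2,
    TopologicalSpace.induced (fun T : H →L[ℂ] H => ∑' n, ⟪p.2 n, T (p.1 n)⟫_ℂ) inferInstance

variable {C : Type u} [CommCStarAlgebra C]
variable {H : Type u} [NormedAddCommGroup H] [InnerProductSpace ℂ H] [CompleteSpace H]

/-- `C` is a von Neumann algebra acting on `H` through the embedding `ρ`. -/
def IsVonNeumann (ρ : C →⋆ₐ[ℂ] (H →L[ℂ] H)) : Prop :=
  Function.Injective ρ ∧ ∃ S : VonNeumannAlgebra H, (S : Set (H →L[ℂ] H)) = Set.range ρ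

/-- The weak* topology of the von Neumann algebra `C`, acting on `H` through `ρ`. -/
@[reducible]
def weakStar (ρ : C →⋆ₐ[ℂ] (H →L[ℂ] H)) : TopologicalSpace C :=
  TopologicalSpace.induced ρ (ultraweak H)

/-- A representation `π` of the von Neumann algebra `C` is normal if it is weak* continuous. -/
def IsNormalRep (ρ : C →⋆ₐ[ℂ] (H →L[ℂ] H)) {K : Type u} [NormedAddCommGroup K]
    [InnerProductSpace ℂ K] [CompleteSpace K] (π : C →⋆ₐ[ℂ] (K →L[ℂ] K)) : Prop :=
  Continuous[weakStar ρ, ultraweak K] π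

end VonNeumann

/-! ### Representable bimodules

A `C`-bimodule is a module over `C` (left action) and over `Cᵐᵒᵖ` (right action); it is central
if `IsCentralScalar` holds. -/

section Bimodule

variable (C : Type u) [CommCStarAlgebra C]
variable {H : Type u} [NormedAddCommGroup H] [InnerProductSpace ℂ H] [CompleteSpace H]

/-- `V` is a representable `C`-bimodule: it embeds isometrically in some `B(L, K)`, where `K` and
`L` are Hilbert modules over `C`. -/
def IsRepresentable (V : Type u) [NormedAddCommGroup V] [NormedSpace ℂ V] [Module C V]
    [Module Cᵐᵒᵖ V] : Prop :=
  ∃ (K : Type u) (_ : NormedAddCommGroup K) (_ : InnerProductSpace ℂ K) (_ : CompleteSpace K)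
    (L : Type u) (_ : NormedAddCommGroup L) (_ : InnerProductSpace ℂ L) (_ : CompleteSpace L)
    (π : C →⋆ₐ[ℂ] (K →L[ℂ] K)) (σ : C →⋆ₐ[ℂ] (L →L[ℂ] L)) (J : V →ₗᵢ[ℂ] (L →L[ℂ] K)),
    (∀ (c : C) (v : V), J (c • v) = (π c).comp (J v)) ∧
    (∀ (c : C) (v : V), J (op c • v) = (J v).comp (σ c))

variable {C}

/-- `V` is a normal representable `C`-bimodule: as `IsRepresentable`, with both representations
of the von Neumann algebra `C` normal. -/
def IsNormalRepresentable (ρ : C →⋆ₐ[ℂ] (H →L[ℂ] H)) (V : Type u) [NormedAddCommGroup V]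
    [NormedSpace ℂ V] [Module C V] [Module Cᵐᵒᵖ V] : Prop :=
  ∃ (K : Type u) (_ : NormedAddCommGroup K) (_ : InnerProductSpace ℂ K) (_ : CompleteSpace K)
    (L : Type u) (_ : NormedAddCommGroup L) (_ : InnerProductSpace ℂ L) (_ : CompleteSpace L)
    (π : C →⋆ₐ[ℂ] (K →L[ℂ] K)) (σ : C →⋆ₐ[ℂ] (L →L[ℂ] L)) (J : V →ₗᵢ[ℂ] (L →L[ℂ] K)),
    IsNormalRep ρ π ∧ IsNormalRep ρ σ ∧
    (∀ (c : C) (v : V), J (c • v) = (π c).comp (J v)) ∧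
    (∀ (c : C) (v : V), J (op c • v) = (J v).comp (σ c))

variable (C)

/-- `C`-bimodule homomorphisms. -/
def IsBimoduleMap {V W : Type u} [SMul C V] [SMul Cᵐᵒᵖ V] [SMul C W] [SMul Cᵐᵒᵖ W]
    (f : V → W) : Prop :=
  ∀ (c : C) (v : V), f (c • v) = c • f v ∧ f (op c • v) = op c • f v

variable {C}

/-- `N`, together with `ι : Z → N`, is the normal part of the representable Banach
`C`-bimodule `Z`. -/
structure IsNormalPart (ρ : C →⋆ₐ[ℂ] (H →L[ℂ] H))
    {Z : Type u} [NormedAddCommGroup Z] [NormedSpace ℂ Z] [Module C Z] [Module Cᵐᵒᵖ Z]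
    {N : Type u} [NormedAddCommGroup N] [NormedSpace ℂ N] [Module C N] [Module Cᵐᵒᵖ N]
    (ι : Z →L[ℂ] N) : Prop where
  complete_left : CompleteSpace Z
  representable : IsRepresentable C Z
  complete : CompleteSpace N
  normal : IsNormalRepresentable ρ N
  contractive : ‖ι‖ ≤ 1
  bimoduleMap : IsBimoduleMap C ι
  universal : ∀ (V : Type u) [NormedAddCommGroup V] [NormedSpace ℂ V] [CompleteSpace V]
    [Module C V] [Module Cᵐᵒᵖ V], IsNormalRepresentable ρ V →
    ∀ T : Z →L[ℂ] V, IsBimoduleMap C T →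
      ∃ T' : N →L[ℂ] V, IsBimoduleMap C T' ∧ T'.comp ι = T ∧ ‖T'‖ ≤ ‖T‖ ∧
        ∀ S : N →L[ℂ] V, IsBimoduleMap C S → S.comp ι = T → S = T'

end Bimodule

/-! ### The projective tensor product -/

section Gamma

variable (R : Type*) [CommRing R] (X Y : Type u)
variable [NormedAddCommGroup X] [Module R X] [NormedAddCommGroup Y] [Module R Y]

/-- The projective tensor seminorm on `X ⊗[R] Y`. -/
def gammaNorm {R : Type*} {X Y : Type u} [CommRing R] [NormedAddCommGroup X] [Module R X] [NormedAddCommGroup Y]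
    [Module R Y] (w : X ⊗[R] Y) : ℝ :=
  sInf {r | ∃ (n : ℕ) (x : Fin n → X) (y : Fin n → Y),
    w = ∑ j, x j ⊗ₜ[R] y j ∧ r = ∑ j, ‖x j‖ * ‖y j‖}

variable {R X Y}

theorem exists_rep (w : X ⊗[R] Y) :
    ∃ (n : ℕ) (x : Fin n → X) (y : Fin n → Y), w = ∑ j, x j ⊗ₜ[R] y j := by
  induction w with
  | zero => exact ⟨0, Fin.elim0, Fin.elim0, by simp⟩
  | tmul x y => exact ⟨1, fun _ => x, fun _ => y, by simp⟩
  | add a b ha hb =>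
    obtain ⟨n, x, y, rfl⟩ := ha
    obtain ⟨m, x', y', rfl⟩ := hb
    exact ⟨n + m, Fin.append x x', Fin.append y y', by simp [Fin.sum_univ_add]⟩

theorem gammaNorm_le {n : ℕ} (x : Fin n → X) (y : Fin n → Y) :
    gammaNorm (∑ j, x j ⊗ₜ[R] y j) ≤ ∑ j, ‖x j‖ * ‖y j‖ := by
  refine csInf_le ⟨0, ?_⟩ ⟨n, x, y, rfl, rfl⟩
  rintro r ⟨n, x, y, -, rfl⟩
  positivity

theorem le_gammaNorm {w : X ⊗[R] Y} {a : ℝ}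
    (h : ∀ (n : ℕ) (x : Fin n → X) (y : Fin n → Y), w = ∑ j, x j ⊗ₜ[R] y j →
      a ≤ ∑ j, ‖x j‖ * ‖y j‖) : a ≤ gammaNorm w := by
  obtain ⟨n, x, y, hw⟩ := exists_rep w
  refine le_csInf ⟨_, n, x, y, hw, rfl⟩ ?_
  rintro r ⟨n, x, y, hw, rfl⟩
  exact h n x y hw

theorem gammaNorm_nonneg (w : X ⊗[R] Y) : 0 ≤ gammaNorm w :=
  le_gammaNorm fun _ _ _ _ => by positivity

theorem gammaNorm_zero : gammaNorm (0 : X ⊗[R] Y) = 0 := by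
  refine le_antisymm ?_ (gammaNorm_nonneg _)
  simpa using gammaNorm_le (R := R) (Fin.elim0 : Fin 0 → X) (Fin.elim0 : Fin 0 → Y)

theorem gammaNorm_add_le (v w : X ⊗[R] Y) : gammaNorm (v + w) ≤ gammaNorm v + gammaNorm w := by
  rw [← sub_le_iff_le_add]
  refine le_gammaNorm fun n x y hv => ?_
  rw [sub_le_iff_le_add, ← sub_le_iff_le_add']
  refine le_gammaNorm fun m x' y' hw => ?_
  rw [sub_le_iff_le_add']
  have := gammaNorm_le (R := R) (Fin.append x x') (Fin.append y y')
  simpa [Fin.sum_univ_add, ← hv, ← hw] using this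

theorem gammaNorm_neg (w : X ⊗[R] Y) : gammaNorm (-w) = gammaNorm w := by
  have key : ∀ w : X ⊗[R] Y, gammaNorm (-w) ≤ gammaNorm w := fun w => by
    refine le_gammaNorm fun n x y hw => ?_
    have := gammaNorm_le (R := R) (fun j => -x j) y
    simpa [TensorProduct.neg_tmul, ← hw] using this
  refine le_antisymm (key w) ?_
  simpa using key (-w)

theorem gammaNorm_smul_le {R' : Type*} [SeminormedRing R'] [Module R' X] [SMulCommClass R R' X]
    [IsBoundedSMul R' X] (c : R') (w : X ⊗[R] Y) : gammaNorm (c • w) ≤ ‖c‖ * gammaNorm w := by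
  have h : ∀ (n : ℕ) (x : Fin n → X) (y : Fin n → Y), w = ∑ j, x j ⊗ₜ[R] y j →
      gammaNorm (c • w) ≤ ‖c‖ * ∑ j, ‖x j‖ * ‖y j‖ := by
    intro n x y hw
    have h1 := gammaNorm_le (R := R) (fun j => c • x j) y
    have h2 : c • w = ∑ j, (c • x j) ⊗ₜ[R] y j := by
      simp [hw, Finset.smul_sum, TensorProduct.smul_tmul']
    rw [h2, Finset.mul_sum]
    refine h1.trans (Finset.sum_le_sum fun j _ => ?_)
    rw [← mul_assoc]
    exact mul_le_mul_of_nonneg_right (norm_smul_le _ _) (norm_nonneg _)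
  rcases (norm_nonneg c).eq_or_lt with hc | hc
  · obtain ⟨n, x, y, hw⟩ := exists_rep w
    simpa [← hc] using h n x y hw
  · rw [← div_le_iff₀' hc]
    refine le_gammaNorm fun n x y hw => ?_
    rw [div_le_iff₀' hc]
    exact h n x y hw

variable (R X Y)

/-- The algebraic tensor product over `R`, equipped with the projective seminorm. -/
def GammaPre : Type u := X ⊗[R] Y

namespace GammaPre

instance : AddCommGroup (GammaPre R X Y) := inferInstanceAs (AddCommGroup (X ⊗[R] Y))

instance {R' : Type*} [Semiring R'] [Module R' X] [SMulCommClass R R' X] :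
    Module R' (GammaPre R X Y) := inferInstanceAs (Module R' (X ⊗[R] Y))

instance {R' : Type*} [Semiring R'] [Module R' X] [SMulCommClass R R' X] [Module R'ᵐᵒᵖ X]
    [IsCentralScalar R' X] : IsCentralScalar R' (GammaPre R X Y) :=
  inferInstanceAs (IsCentralScalar R' (X ⊗[R] Y))

instance : SeminormedAddCommGroup (GammaPre R X Y) :=
  AddGroupSeminorm.toSeminormedAddCommGroup
    { toFun := fun w : X ⊗[R] Y => gammaNorm w
      map_zero' := gammaNorm_zero
      add_le' := gammaNorm_add_le
      neg' := gammaNorm_neg }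

instance {R' : Type*} [SeminormedRing R'] [Module R' X] [SMulCommClass R R' X]
    [IsBoundedSMul R' X] : IsBoundedSMul R' (GammaPre R X Y) :=
  IsBoundedSMul.of_norm_smul_le fun c w => gammaNorm_smul_le (R := R) (X := X) (Y := Y) c w

instance [NormedSpace ℂ X] [SMulCommClass R ℂ X] : NormedSpace ℂ (GammaPre R X Y) where
  norm_smul_le := norm_smul_le

end GammaPre

/-- The projective tensor product of Banach `R`-modules: the (Hausdorff) completion of
`X ⊗[R] Y` for the projective seminorm. For `R = ℂ` it is the projective tensor product of
Banach spaces. -/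
abbrev Gamma : Type u := Completion (GammaPre R X Y)

variable {X Y}

/-- The elementary tensor `x ⊗ y` in the projective tensor product. -/
def Gamma.tmul (x : X) (y : Y) : Gamma R X Y :=
  ((show GammaPre R X Y from x ⊗ₜ[R] y : GammaPre R X Y) : Completion (GammaPre R X Y))

theorem Gamma.norm_tmul_le (x : X) (y : Y) : ‖Gamma.tmul R x y‖ ≤ ‖x‖ * ‖y‖ := by
  unfold Gamma.tmul
  rw [Completion.norm_coe]
  have := gammaNorm_le (R := R) (fun _ : Fin 1 => x) (fun _ => y)
  simp only [Finset.univ_unique, Finset.sum_singleton] at this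
  exact this

end Gamma

/-! ### The normal projective tensor product -/

section Nu

variable {C : Type u} [CommCStarAlgebra C]
variable {H : Type u} [NormedAddCommGroup H] [InnerProductSpace ℂ H] [CompleteSpace H]
variable (ρ : C →⋆ₐ[ℂ] (H →L[ℂ] H))
variable {X Y : Type u}
variable [NormedAddCommGroup X] [NormedSpace ℂ X] [Module C X] [IsScalarTower ℂ C X]
  [Module Cᵐᵒᵖ X]
variable [NormedAddCommGroup Y] [NormedSpace ℂ Y] [Module C Y] [IsScalarTower ℂ C Y]
  [Module Cᵐᵒᵖ Y]

/-- The values `‖φ(w)‖`, where `φ` runs over all `C`-bilinear contractions from `X × Y` into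
normal representable Banach `C`-bimodules. -/
def nuSet (w : X ⊗[C] Y) : Set ℝ :=
  {r | ∃ (V : Type u) (_ : NormedAddCommGroup V) (_ : NormedSpace ℂ V) (_ : CompleteSpace V)
    (_ : Module C V) (_ : Module Cᵐᵒᵖ V) (φ : X →ₗ[C] Y →ₗ[C] V),
    IsNormalRepresentable ρ V ∧ (∀ (c : C) (x : X) (y : Y), φ x (op c • y) = op c • φ x y) ∧
    (∀ x y, ‖φ x y‖ ≤ ‖x‖ * ‖y‖) ∧ r = ‖TensorProduct.lift φ w‖}

/-- The norm `ν_C` on `X ⊗[C] Y`. -/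
def nuNorm (w : X ⊗[C] Y) : ℝ := sSup (nuSet ρ w)

theorem nuSet_le {w : X ⊗[C] Y} {r : ℝ} (hr : r ∈ nuSet ρ w) : r ≤ gammaNorm w := by
  obtain ⟨V, _, _, _, _, _, φ, -, -, hφ, rfl⟩ := hr
  refine le_gammaNorm fun n x y hw => ?_
  rw [hw, map_sum]
  refine (norm_sum_le _ _).trans (Finset.sum_le_sum fun j _ => ?_)
  simpa using hφ (x j) (y j)

theorem nuSet_bddAbove (w : X ⊗[C] Y) : BddAbove (nuSet ρ w) :=
  ⟨gammaNorm w, fun _ => nuSet_le ρ⟩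

theorem nuNorm_nonneg (w : X ⊗[C] Y) : 0 ≤ nuNorm ρ w := by
  refine Real.sSup_nonneg ?_
  rintro r ⟨V, _, _, _, _, _, φ, -, -, -, rfl⟩
  exact norm_nonneg _

theorem nuNorm_zero : nuNorm ρ (0 : X ⊗[C] Y) = 0 := by
  refine le_antisymm (Real.sSup_le ?_ le_rfl) (nuNorm_nonneg ρ _)
  rintro r ⟨V, _, _, _, _, _, φ, -, -, -, rfl⟩
  simp

theorem nuNorm_add_le (v w : X ⊗[C] Y) : nuNorm ρ (v + w) ≤ nuNorm ρ v + nuNorm ρ w := by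
  refine Real.sSup_le ?_ (add_nonneg (nuNorm_nonneg ρ _) (nuNorm_nonneg ρ _))
  rintro r ⟨V, i1, i2, i3, i4, i5, φ, h1, h2, h3, rfl⟩
  rw [map_add]
  exact (norm_add_le _ _).trans (add_le_add
    (le_csSup (nuSet_bddAbove ρ v) ⟨V, i1, i2, i3, i4, i5, φ, h1, h2, h3, rfl⟩)
    (le_csSup (nuSet_bddAbove ρ w) ⟨V, i1, i2, i3, i4, i5, φ, h1, h2, h3, rfl⟩))

theorem nuNorm_neg (w : X ⊗[C] Y) : nuNorm ρ (-w) = nuNorm ρ w := by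
  unfold nuNorm nuSet
  simp only [map_neg, norm_neg]

theorem nuNorm_smul_le (c : C) (w : X ⊗[C] Y) : nuNorm ρ (c • w) ≤ ‖c‖ * nuNorm ρ w := by
  refine Real.sSup_le ?_ (mul_nonneg (norm_nonneg _) (nuNorm_nonneg ρ _))
  rintro r ⟨V, i1, i2, i3, i4, i5, φ, h1, h2, h3, rfl⟩
  have hle := le_csSup (nuSet_bddAbove ρ w) ⟨V, i1, i2, i3, i4, i5, φ, h1, h2, h3, rfl⟩
  obtain ⟨K, _, _, _, L, _, _, _, π, σ, J, -, -, hl, -⟩ := h1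
  rw [map_smul, ← J.norm_map, hl]
  calc _ ≤ ‖π c‖ * ‖J (TensorProduct.lift φ w)‖ := ContinuousLinearMap.opNorm_comp_le _ _
    _ ≤ ‖c‖ * ‖TensorProduct.lift φ w‖ := by
      rw [J.norm_map]
      exact mul_le_mul_of_nonneg_right (NonUnitalStarAlgHom.norm_apply_le π c) (norm_nonneg _)
    _ ≤ _ := mul_le_mul_of_nonneg_left hle (norm_nonneg _)

variable (X Y)

/-- The algebraic tensor product over `C`, equipped with `ν_C`. -/
def NuPre (_ : C →⋆ₐ[ℂ] (H →L[ℂ] H)) (X Y : Type u) [NormedAddCommGroup X] [Module C X]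
    [NormedAddCommGroup Y] [Module C Y] : Type u := X ⊗[C] Y

namespace NuPre

instance : AddCommGroup (NuPre ρ X Y) := inferInstanceAs (AddCommGroup (X ⊗[C] Y))

instance {R' : Type*} [Semiring R'] [Module R' X] [SMulCommClass C R' X] :
    Module R' (NuPre ρ X Y) := inferInstanceAs (Module R' (X ⊗[C] Y))

instance [IsCentralScalar C X] : IsCentralScalar C (NuPre ρ X Y) :=
  inferInstanceAs (IsCentralScalar C (X ⊗[C] Y))

instance : IsScalarTower ℂ C (NuPre ρ X Y) :=
  inferInstanceAs (IsScalarTower ℂ C (X ⊗[C] Y))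

instance : SeminormedAddCommGroup (NuPre ρ X Y) :=
  AddGroupSeminorm.toSeminormedAddCommGroup
    { toFun := fun w : X ⊗[C] Y => nuNorm ρ w
      map_zero' := nuNorm_zero ρ
      add_le' := nuNorm_add_le ρ
      neg' := nuNorm_neg ρ }

instance : IsBoundedSMul C (NuPre ρ X Y) :=
  IsBoundedSMul.of_norm_smul_le fun c w => nuNorm_smul_le (X := X) (Y := Y) ρ c w

instance : NormedSpace ℂ (NuPre ρ X Y) where
  norm_smul_le z w := by
    rcases subsingleton_or_nontrivial C with hC | hC
    · have : w = 0 := by rw [← one_smul C w, Subsingleton.elim (1 : C) 0, zero_smul]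
      simp [this]
    · rw [← algebraMap_smul C z w]
      refine (norm_smul_le _ _).trans ?_
      rw [norm_algebraMap']

end NuPre

/-- The normal projective tensor product: the completion of `X ⊗[C] Y` for `ν_C`. -/
abbrev Nu : Type u := Completion (NuPre ρ X Y)

variable {X Y}

/-- The elementary tensor `x ⊗ y` in the normal projective tensor product. -/
def Nu.tmul (x : X) (y : Y) : Nu ρ X Y :=
  ((show NuPre ρ X Y from x ⊗ₜ[C] y : NuPre ρ X Y) : Completion (NuPre ρ X Y))

end Nu

/-! ### Fibres over the spectrum -/

section Fiber

variable {C : Type u} [CommCStarAlgebra C] (t : characterSpace ℂ C)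
variable (X : Type u) [NormedAddCommGroup X] [NormedSpace ℂ X] [Module C X]

/-- The closed subspace `[C_t X]` of `X`, where `C_t` is the kernel of the character `t`. -/
def fiberKer : Submodule ℂ X :=
  (Submodule.span ℂ {z : X | ∃ (c : C) (x : X), t c = 0 ∧ z = c • x}).topologicalClosure

instance : IsClosed (fiberKer t X : Set X) := Submodule.isClosed_topologicalClosure _

/-- The fibre `X(t) = X / [C_t X]`, with the quotient norm. -/
abbrev Fiber : Type u := X ⧸ fiberKer t X

variable {X}

/-- The class `x(t)` of `x` in `X(t)`. -/
def Fiber.mk (x : X) : Fiber t X := (fiberKer t X).mkQ x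

theorem Fiber.norm_mk_le (x : X) : ‖Fiber.mk t x‖ ≤ ‖x‖ :=
  Submodule.Quotient.norm_mk_le (fiberKer t X) x

end Fiber

/-! ### Essential direct sums -/

section EssSum

variable {Δ : Type u} [TopologicalSpace Δ]

/-- The essential supremum of a function on `Δ` with respect to meagre sets. -/
def essup (f : Δ → ℝ) : ℝ := sInf {c : ℝ | IsMeagre {t | c < f t}}

variable [BaireSpace Δ] (E : Δ → Type u) [∀ t, NormedAddCommGroup (E t)]

theorem essup_lower {f : Δ → ℝ} [Nonempty Δ] (hf : ∀ t, 0 ≤ f t) {c : ℝ}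
    (hc : IsMeagre {t | c < f t}) : 0 ≤ c := by
  by_contra! h
  have : {t | c < f t} = Set.univ := Set.eq_univ_of_forall fun t => h.trans_le (hf t)
  rw [this] at hc
  have hd := dense_of_mem_residual hc
  rw [Set.compl_univ] at hd
  exact Set.not_nonempty_empty hd.nonempty

theorem essup_of_isEmpty [IsEmpty Δ] (f : Δ → ℝ) : essup f = 0 := by
  have : {c : ℝ | IsMeagre {t | c < f t}} = Set.univ :=
    Set.eq_univ_of_forall fun c => by
      have : {t | c < f t} = ∅ := Set.eq_empty_of_isEmpty _
      simp [this, IsMeagre.empty]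
  rw [essup, this, Real.sInf_univ]

theorem essup_zero : essup (fun _ : Δ => (0 : ℝ)) = 0 := by
  rcases isEmpty_or_nonempty Δ with h | h
  · exact essup_of_isEmpty _
  · refine le_antisymm (csInf_le ⟨0, fun c hc => essup_lower (fun _ => le_rfl) hc⟩ ?_)
      (Real.sInf_nonneg fun c hc => essup_lower (fun _ => le_rfl) hc)
    simp [IsMeagre.empty]

theorem essup_norm_add_le (x y : lp E ∞) :
    essup (fun t => ‖(x + y) t‖) ≤ essup (fun t => ‖x t‖) + essup (fun t => ‖y t‖) := by
  rcases isEmpty_or_nonempty Δ with h | h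
  · simp [essup_of_isEmpty]
  have ne : ∀ z : lp E ∞, {c : ℝ | IsMeagre {t | c < ‖z t‖}}.Nonempty := fun z => by
    refine ⟨‖z‖, ?_⟩
    have : {t | ‖z‖ < ‖z t‖} = ∅ :=
      Set.eq_empty_of_forall_notMem fun t ht =>
        absurd (lp.norm_apply_le_norm ENNReal.top_ne_zero z t) (not_le.2 ht)
    simp [this, IsMeagre.empty]
  have bd : ∀ z : lp E ∞, BddBelow {c : ℝ | IsMeagre {t | c < ‖z t‖}} := fun z =>
    ⟨0, fun c hc => essup_lower (fun t => norm_nonneg _) hc⟩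
  rw [← sub_le_iff_le_add]
  refine le_csInf (ne x) fun a ha => ?_
  rw [sub_le_iff_le_add, ← sub_le_iff_le_add']
  refine le_csInf (ne y) fun b hb => ?_
  rw [sub_le_iff_le_add']
  refine csInf_le (bd _) ((IsMeagre.union ha hb).mono fun t ht => ?_)
  by_contra hn
  simp only [Set.mem_union, Set.mem_ofPred_eq, not_or, not_lt] at hn ht
  have := norm_add_le (x t) (y t)
  have h2 : (x + y) t = x t + y t := rfl
  rw [h2] at ht
  linarith [hn.1, hn.2]

/-- The `ℓ^∞`-direct sum of the spaces `E t`, with the seminorm `x ↦ essup ‖x t‖`. -/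
def EssPre : Type u := lp E ∞

namespace EssPre

instance : AddCommGroup (EssPre E) := inferInstanceAs (AddCommGroup (lp E ∞))

instance [∀ t, NormedSpace ℂ (E t)] : Module ℂ (EssPre E) := inferInstanceAs (Module ℂ (lp E ∞))

instance : SeminormedAddCommGroup (EssPre E) :=
  AddGroupSeminorm.toSeminormedAddCommGroup
    { toFun := fun x : lp E ∞ => essup fun t => ‖x t‖
      map_zero' := by
        have : (fun t => ‖(0 : lp E ∞) t‖) = fun _ => (0 : ℝ) := funext fun t => norm_zero
        exact (congrArg essup this).trans essup_zero
      add_le' := essup_norm_add_le E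
      neg' := fun x : lp E ∞ => congrArg essup (funext fun t => norm_neg (x t)) }

instance [∀ t, NormedSpace ℂ (E t)] : NormedSpace ℂ (EssPre E) where
  norm_smul_le z x := by
    rcases eq_or_ne z 0 with rfl | hz
    · simp
    change essup (fun t => ‖z • (show lp E ∞ from x) t‖) ≤
      ‖z‖ * essup (fun t => ‖(show lp E ∞ from x) t‖)
    have hz' : 0 < ‖z‖ := norm_pos_iff.2 hz
    rw [← div_le_iff₀' hz']
    rcases isEmpty_or_nonempty Δ with h | h
    · simp [essup_of_isEmpty]
    refine le_csInf ⟨‖(show lp E ∞ from x)‖, ?_⟩ fun a ha => ?_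
    · have : {t | ‖(show lp E ∞ from x)‖ < ‖(show lp E ∞ from x) t‖} = ∅ :=
        Set.eq_empty_of_forall_notMem fun t ht =>
          absurd (lp.norm_apply_le_norm ENNReal.top_ne_zero (show lp E ∞ from x) t) (not_le.2 ht)
      rw [Set.mem_ofPred_eq, this]
      exact IsMeagre.empty
    · rw [div_le_iff₀' hz']
      refine csInf_le ⟨0, fun c hc => essup_lower (fun t => norm_nonneg _) hc⟩ (ha.mono ?_)
      intro t ht
      simp only [Set.mem_ofPred_eq, norm_smul] at ht ⊢
      exact lt_of_mul_lt_mul_left ht hz'.le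

end EssPre

/-- The essential direct sum of the Banach spaces `E t`: the quotient of their `ℓ^∞`-direct sum
by the zero space of the seminorm `x ↦ essup ‖x t‖`. -/
abbrev EssSum : Type u := SeparationQuotient (EssPre E)

variable {E}

/-- The quotient map from the `ℓ^∞`-direct sum to the essential direct sum. -/
def EssSum.mk (x : lp E ∞) : EssSum E := SeparationQuotient.mk (show EssPre E from x)

end EssSum

/-! ### The canonical decomposition of the tensor product -/

section Canonical

variable {C : Type u} [CommCStarAlgebra C]
variable {X Y : Type u}
variable [NormedAddCommGroup X] [NormedSpace ℂ X] [Module C X]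
variable [NormedAddCommGroup Y] [NormedSpace ℂ Y] [Module C Y]

/-- The family `(x(t) ⊗ y(t))_t` in the `ℓ^∞`-direct sum of the projective tensor products of
Banach spaces `X(t) ⊗ Y(t)`, for `t` in the spectrum of `C`. -/
def fiberTensor (x : X) (y : Y) :
    lp (fun t : characterSpace ℂ C => Gamma ℂ (Fiber t X) (Fiber t Y)) ∞ :=
  ⟨fun t => Gamma.tmul ℂ (Fiber.mk t x) (Fiber.mk t y), memℓp_infty ⟨‖x‖ * ‖y‖, by
    rintro _ ⟨t, rfl⟩
    exact (Gamma.norm_tmul_le ℂ _ _).trans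
      (mul_le_mul (Fiber.norm_mk_le t x) (Fiber.norm_mk_le t y) (norm_nonneg _)
        (norm_nonneg _))⟩⟩

end Canonical

end CentralModule

end

open CentralModule

set_option linter.unusedSectionVars false

noncomputable section

namespace CentralModule

open Filter Set

/-! ### The spectrum of an Abelian von Neumann algebra -/

section Spectrum

variable {C : Type u} [CommCStarAlgebra C]

/-! By Gelfand duality `C` is the algebra of continuous functions on its spectrum Δ. Since `C` is a
von Neumann algebra, Δ is extremally disconnected (`extremallyDisconnected_characterSpace`), so
clopen sets, which are the projections of `C`, form a base. Write w(t) for the image of w in X(t) ⊗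
Y(t). Everything follows from two norm formulas.

The first is γ_C(w) = sup_t γ(w(t)). A tensor with w(t) = 0 is small on clopen neighbourhoods of t
(`locallyNull_of_fiberMap_eq_zero`), so a bound γ(w(t)) < r persists for γ_C(pw) with a projection p
equal to 1 near t. Compactness and the rule γ_C(w) ≤ max(γ_C(pw), γ_C((1-p)w)) (`gammaNorm_le_max`)
glue these local bounds. In particular t ↦ γ(w(t)) is upper semicontinuous.

The second is ν_C(w) = ess sup_t γ(w(t)) (`nuNorm_eq_essNorm`). For ≤: if r exceeds the essential
supremum, then {γ(w(t)) < r} is open and, by Baire, dense. The projections of the clopen sets inside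
it converge weak* to 1, so a normal functional, which is at most r on each truncation pw, is at most
r on w (`norm_le_essNorm_of_normal`). Matrix coefficients reduce maps into normal representable
bimodules to such functionals. For ≥: functionals norming w(t), chosen separately in each fibre, are
glued by ultrafilter limits to a contractive bilinear map into `C`. This uses a continuous selection
of ultrafilters converging to the points of Δ, given by projectivity of Δ (`essNorm_le_of_forall`).

Since `C` is itself normal representable, the second formula gives (ii), (iii) and the isometry in
(i). Representability of the completions follows by taking direct sums over norming families of
functionals or of maps into `C`. The universal property holds because a bimodule map on Z, divided
by its norm, is one of the contractions that define ν_C. -/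

theorem eq_of_forall_character {a b : C} (h : ∀ t : characterSpace ℂ C, t a = t b) : a = b := by
  apply (gelfandStarTransform C).injective
  ext t
  exact h t

theorem norm_le_of_forall_character {a : C} {r : ℝ} (hr : 0 ≤ r)
    (h : ∀ t : characterSpace ℂ C, ‖t a‖ ≤ r) : ‖a‖ ≤ r := by
  rw [← (gelfandTransform_isometry C).norm_map_of_map_zero (map_zero _) a,
    ContinuousMap.norm_le _ hr]
  exact h

theorem norm_character_le (t : characterSpace ℂ C) (a : C) : ‖t a‖ ≤ ‖a‖ := by
  rw [← (gelfandTransform_isometry C).norm_map_of_map_zero (map_zero _) a]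
  exact ContinuousMap.norm_coe_le_norm (gelfandTransform ℂ C a) t

theorem exists_eq_character (f : C(characterSpace ℂ C, ℂ)) :
    ∃ a : C, ∀ t : characterSpace ℂ C, t a = f t := by
  obtain ⟨a, ha⟩ := (gelfandStarTransform C).surjective f
  exact ⟨a, fun t => by rw [← ha]; rfl⟩

theorem continuous_character (a : C) : Continuous fun t : characterSpace ℂ C => t a :=
  (gelfandTransform ℂ C a).continuous

/-- The projection of `C` that corresponds to a clopen subset of the spectrum. -/
def clopenProj (U : TopologicalSpace.Clopens (characterSpace ℂ C)) : C :=
  (exists_eq_character ⟨(U : Set (characterSpace ℂ C)).indicator 1,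
    continuous_one.indicator (by simp [U.isClopen.frontier_eq])⟩).choose

theorem character_clopenProj (t : characterSpace ℂ C)
    (U : TopologicalSpace.Clopens (characterSpace ℂ C)) :
    t (clopenProj U) = (U : Set (characterSpace ℂ C)).indicator 1 t :=
  (exists_eq_character ⟨(U : Set (characterSpace ℂ C)).indicator 1,
    continuous_one.indicator (by simp [U.isClopen.frontier_eq])⟩).choose_spec t

theorem character_clopenProj_of_mem {t : characterSpace ℂ C}
    {U : TopologicalSpace.Clopens (characterSpace ℂ C)} (h : t ∈ U) : t (clopenProj U) = 1 := by
  rw [character_clopenProj, indicator_of_mem (by exact h), Pi.one_apply]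

theorem character_clopenProj_of_notMem {t : characterSpace ℂ C}
    {U : TopologicalSpace.Clopens (characterSpace ℂ C)} (h : t ∉ U) : t (clopenProj U) = 0 := by
  rw [character_clopenProj, indicator_of_notMem (by exact h)]

theorem norm_clopenProj_le (U : TopologicalSpace.Clopens (characterSpace ℂ C)) :
    ‖clopenProj U‖ ≤ 1 := by
  refine norm_le_of_forall_character zero_le_one fun t => ?_
  by_cases h : t ∈ U
  · simp [character_clopenProj_of_mem h]
  · simp [character_clopenProj_of_notMem h]

theorem clopenProj_inf (U V : TopologicalSpace.Clopens (characterSpace ℂ C)) :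
    clopenProj (U ⊓ V) = clopenProj U * clopenProj V := by
  refine eq_of_forall_character fun t => ?_
  simp only [map_mul, character_clopenProj, TopologicalSpace.Clopens.coe_inf]
  exact congrFun (inter_indicator_one (M₀ := ℂ) (s := (U : Set (characterSpace ℂ C))) (t := V)) t

theorem clopenProj_mul_of_le {U V : TopologicalSpace.Clopens (characterSpace ℂ C)} (h : U ≤ V) :
    clopenProj U * clopenProj V = clopenProj U := by
  rw [← clopenProj_inf, inf_eq_left.2 h]

theorem clopenProj_mul_self (U : TopologicalSpace.Clopens (characterSpace ℂ C)) :
    clopenProj U * clopenProj U = clopenProj U :=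
  clopenProj_mul_of_le le_rfl

theorem clopenProj_top : clopenProj (⊤ : TopologicalSpace.Clopens (characterSpace ℂ C)) = 1 :=
  eq_of_forall_character fun t => by
    rw [character_clopenProj_of_mem
      (show t ∈ (⊤ : TopologicalSpace.Clopens (characterSpace ℂ C)) from mem_univ t), map_one]

theorem one_sub_clopenProj (U : TopologicalSpace.Clopens (characterSpace ℂ C)) :
    1 - clopenProj U = clopenProj Uᶜ := by
  refine eq_of_forall_character fun t => ?_
  rw [map_sub, map_one]
  by_cases h : t ∈ U
  · rw [character_clopenProj_of_mem h,
      character_clopenProj_of_notMem fun h' : t ∈ Uᶜ => (h' : t ∉ U) h, sub_self]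
  · rw [character_clopenProj_of_notMem h,
      character_clopenProj_of_mem (show t ∈ Uᶜ from h), sub_zero]

theorem star_clopenProj (U : TopologicalSpace.Clopens (characterSpace ℂ C)) :
    star (clopenProj U) = clopenProj U := by
  refine eq_of_forall_character fun t => ?_
  rw [map_star]
  by_cases h : t ∈ U
  · simp [character_clopenProj_of_mem h]
  · simp [character_clopenProj_of_notMem h]

/-! ### Support projections of open sets; the spectrum is extremally disconnected. -/

variable {H : Type u} [NormedAddCommGroup H] [InnerProductSpace ℂ H] [CompleteSpace H]
variable {ρ : C →⋆ₐ[ℂ] (H →L[ℂ] H)}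

/-- The closed span of the ranges of the operators `ρ c`, where the Gelfand transform of `c`
vanishes outside `U`. -/
def openRange (ρ : C →⋆ₐ[ℂ] (H →L[ℂ] H)) (U : Set (characterSpace ℂ C)) : Submodule ℂ H :=
  (Submodule.span ℂ {z : H | ∃ (c : C) (x : H), (∀ t ∉ U, t c = 0) ∧ z = ρ c x}).topologicalClosure

instance (U : Set (characterSpace ℂ C)) : CompleteSpace (openRange ρ U) :=
  (Submodule.isClosed_topologicalClosure _).completeSpace_coe

theorem exists_mem_support {U : Set (characterSpace ℂ C)} (hU : IsOpen U)
    {t : characterSpace ℂ C} (ht : t ∈ U) : ∃ c : C, (∀ s ∉ U, s c = 0) ∧ t c = 1 := by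
  obtain ⟨f, hf0, hf1, -⟩ := exists_continuous_zero_one_of_isClosed hU.isClosed_compl
    (isClosed_singleton (x := t)) (by simpa using ht)
  obtain ⟨c, hc⟩ := exists_eq_character ((⟨Complex.ofReal, Complex.continuous_ofReal⟩ :
    C(ℝ, ℂ)).comp f)
  refine ⟨c, fun s hs => ?_, ?_⟩
  · rw [hc]
    simpa using hf0 hs
  · rw [hc]
    simpa using hf1 (mem_singleton t)

/-- A projection belongs to a von Neumann algebra as soon as its range is invariant under the
commutant. Here the generators `ρ c x` are sent to `ρ c (y x)` by any `y` in the commutant. -/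
theorem exists_starProjection_openRange (hρ : IsVonNeumann ρ) (U : Set (characterSpace ℂ C)) :
    ∃ q : C, ρ q = (openRange ρ U).starProjection := by
  obtain ⟨-, S, hS⟩ := hρ
  suffices (openRange ρ U).starProjection ∈ S by
    rw [← SetLike.mem_coe, hS] at this
    exact this
  rw [VonNeumannAlgebra.IsStarProjection.mem_iff isStarProjection_starProjection]
  intro y hy
  rw [Submodule.range_starProjection, Module.End.mem_invtSubmodule]
  refine Submodule.topologicalClosure_minimal _ ?_
    ((Submodule.isClosed_topologicalClosure _).preimage y.continuous)
  rw [Submodule.span_le]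
  rintro _ ⟨c, x, hc, rfl⟩
  refine Submodule.le_topologicalClosure _ (Submodule.subset_span ⟨c, y x, hc, ?_⟩)
  have hc : ρ c ∈ S := by
    rw [← SetLike.mem_coe, hS]
    exact mem_range_self c
  exact (congrArg (fun T : H →L[ℂ] H => T x)
    (VonNeumannAlgebra.mem_commutant_iff.1 hy _ hc)).symm

/-- If `c` is supported in `U`, then `q * c = c`, and evaluating where `c` equals 1 gives the value
1. If `d` vanishes on the closure of `U`, then `d` kills every such `c`, hence the whole range of
`q`, and evaluating `d * q = 0` where `d` equals 1 gives the value 0. -/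
theorem character_eq_of_openRange (hρ : IsVonNeumann ρ) {U : Set (characterSpace ℂ C)}
    (hU : IsOpen U) {q : C} (hq : ρ q = (openRange ρ U).starProjection) :
    (∀ t ∈ U, t q = 1) ∧ ∀ t ∉ closure U, t q = 0 := by
  constructor
  · intro t ht
    obtain ⟨c, hc, htc⟩ := exists_mem_support hU ht
    have : q * c = c := by
      apply hρ.1
      ext x
      rw [map_mul, hq, mul_apply_eq_comp]
      exact Submodule.starProjection_eq_self_iff.2
        (Submodule.le_topologicalClosure _ (Submodule.subset_span ⟨c, x, hc, rfl⟩))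
    have := congrArg t this
    rwa [map_mul, htc, mul_one] at this
  · intro t ht
    obtain ⟨d, hd, htd⟩ := exists_mem_support isClosed_closure.isOpen_compl
      (show t ∈ (closure U)ᶜ from ht)
    have key : openRange ρ U ≤ LinearMap.ker (ρ d : H →ₗ[ℂ] H) := by
      refine Submodule.topologicalClosure_minimal _ ?_ (ρ d).isClosed_ker
      rw [Submodule.span_le]
      rintro _ ⟨c, x, hc, rfl⟩
      have : d * c = 0 := by
        refine eq_of_forall_character fun s => ?_
        rw [map_mul, map_zero]
        by_cases hs : s ∈ U
        · rw [hd s (not_not.2 (subset_closure hs)), zero_mul]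
        · rw [hc s hs, mul_zero]
      change ρ d (ρ c x) = 0
      rw [← mul_apply_eq_comp, ← map_mul, this, map_zero]
      rfl
    have : d * q = 0 := by
      apply hρ.1
      ext x
      rw [map_mul, hq, map_zero, mul_apply_eq_comp]
      exact key (Submodule.starProjection_apply_mem _ x)
    have := congrArg t this
    rwa [map_mul, htd, one_mul, map_zero] at this

/-- By continuity the value 1 of `q` on `U` extends to the closure, so the closure of `U` is the set
where `q` does not vanish, which is open. -/
theorem extremallyDisconnected_characterSpace (hρ : IsVonNeumann ρ) :
    ExtremallyDisconnected (characterSpace ℂ C) := by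
  refine ⟨fun U hU => ?_⟩
  obtain ⟨q, hq⟩ := exists_starProjection_openRange hρ U
  obtain ⟨h1, h0⟩ := character_eq_of_openRange hρ hU hq
  have h1' : ∀ t ∈ closure U, t q = 1 := fun t ht =>
    closure_minimal (t := {t : characterSpace ℂ C | t q = 1}) (fun t ht => h1 t ht)
      (isClosed_eq (continuous_character q) continuous_const) ht
  have : closure U = {t : characterSpace ℂ C | t q ≠ 0} := by
    ext t
    refine ⟨fun ht => by simp [h1' t ht], fun ht => ?_⟩
    by_contra hn
    exact ht (h0 t hn)
  rw [this]
  exact isOpen_ne_fun (continuous_character q) continuous_const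

/-- For dense `U` the support projection has Gelfand transform 1 on a dense set, hence everywhere.
This is where the weak* topology meets the topology of the spectrum. -/
theorem openRange_eq_top (hρ : IsVonNeumann ρ) {U : Set (characterSpace ℂ C)}
    (hU : IsOpen U) (hd : Dense U) : openRange ρ U = ⊤ := by
  obtain ⟨q, hq⟩ := exists_starProjection_openRange hρ U
  have h1 := (character_eq_of_openRange hρ hU hq).1
  have : q = 1 := by
    refine eq_of_forall_character fun t => ?_
    rw [map_one]
    exact closure_minimal (t := {t : characterSpace ℂ C | t q = 1}) (fun t ht => h1 t ht)
      (isClosed_eq (continuous_character q) continuous_const) (hd t)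
  rw [eq_top_iff]
  intro x _
  rw [← Submodule.starProjection_eq_self_iff, ← hq, this, map_one]
  rfl

/-- Clopen neighbourhoods inside open neighbourhoods. -/
theorem exists_clopen_subset [ExtremallyDisconnected (characterSpace ℂ C)]
    {U : Set (characterSpace ℂ C)} (hU : IsOpen U) {t : characterSpace ℂ C} (ht : t ∈ U) :
    ∃ V : TopologicalSpace.Clopens (characterSpace ℂ C), t ∈ V ∧ (V : Set _) ⊆ U := by
  obtain ⟨V, hV, htV, hVU⟩ := compact_exists_isClopen_in_isOpen hU ht
  exact ⟨⟨V, hV⟩, htV, hVU⟩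

theorem exists_clopen_between [ExtremallyDisconnected (characterSpace ℂ C)]
    {K U : Set (characterSpace ℂ C)} (hK : IsClosed K) (hU : IsOpen U) (hKU : K ⊆ U) :
    ∃ V : TopologicalSpace.Clopens (characterSpace ℂ C), K ⊆ V ∧ (V : Set _) ⊆ U := by
  refine hK.isCompact.induction_on (p := fun S => ∃ V : TopologicalSpace.Clopens
    (characterSpace ℂ C), S ⊆ V ∧ (V : Set _) ⊆ U) ⟨⊥, by simp, by simp⟩ ?_ ?_ ?_
  · rintro S T hST ⟨V, h1, h2⟩
    exact ⟨V, hST.trans h1, h2⟩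
  · rintro S T ⟨V, h1, h2⟩ ⟨W, h3, h4⟩
    exact ⟨V ⊔ W, by simpa using ⟨h1.trans subset_union_left, h3.trans subset_union_right⟩,
      by simpa using ⟨h2, h4⟩⟩
  · intro t ht
    obtain ⟨V, h1, h2⟩ := exists_clopen_subset hU (hKU ht)
    exact ⟨V, mem_nhdsWithin_of_mem_nhds (V.isClopen.isOpen.mem_nhds h1), V, subset_rfl, h2⟩

end Spectrum

end CentralModule

end

noncomputable section

namespace CentralModule

open Filter Set TopologicalSpace

/-! ### Central modules and projections -/

section Central

variable {C : Type u} [CommCStarAlgebra C]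
variable {H : Type u} [NormedAddCommGroup H] [InnerProductSpace ℂ H] [CompleteSpace H]
variable {ρ : C →⋆ₐ[ℂ] (H →L[ℂ] H)}

theorem IsNormalRepresentable.isRepresentable {V : Type u} [NormedAddCommGroup V]
    [NormedSpace ℂ V] [Module C V] [Module Cᵐᵒᵖ V] (h : IsNormalRepresentable ρ V) :
    IsRepresentable C V := by
  obtain ⟨K, i1, i2, i3, L, i4, i5, i6, π, σ, J, -, -, hl, hr⟩ := h
  exact ⟨K, i1, i2, i3, L, i4, i5, i6, π, σ, J, hl, hr⟩

theorem IsRepresentable.isScalarTower {V : Type u} [NormedAddCommGroup V]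
    [NormedSpace ℂ V] [Module C V] [Module Cᵐᵒᵖ V] (h : IsRepresentable C V) :
    IsScalarTower ℂ C V := by
  obtain ⟨K, _, _, _, L, _, _, _, π, σ, J, hl, hr⟩ := h
  refine ⟨fun z c v => J.injective ?_⟩
  rw [hl, map_smul, map_smul, hl, ContinuousLinearMap.smul_comp]

/-- Orthogonality of the ranges of a projection and its complement. -/
theorem norm_sq_add_of_isProj {K : Type*} [NormedAddCommGroup K] [InnerProductSpace ℂ K]
    [CompleteSpace K] (π : C →⋆ₐ[ℂ] (K →L[ℂ] K)) (U : Clopens (characterSpace ℂ C)) (a b : K) :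
    ‖π (clopenProj U) a + π (1 - clopenProj U) b‖ ^ 2 =
      ‖π (clopenProj U) a‖ ^ 2 + ‖π (1 - clopenProj U) b‖ ^ 2 := by
  have : ⟪π (clopenProj U) a, π (1 - clopenProj U) b⟫_ℂ = 0 := by
    have h : π (clopenProj U) = ContinuousLinearMap.adjoint (π (clopenProj U)) := by
      rw [← ContinuousLinearMap.star_eq_adjoint, ← map_star, star_clopenProj]
    rw [h, ContinuousLinearMap.adjoint_inner_left, ← mul_apply_eq_comp, ← map_mul, mul_sub,
      clopenProj_mul_self, mul_one, sub_self, map_zero]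
    simp
  rw [sq, sq, sq]
  exact norm_add_sq_eq_norm_sq_add_norm_sq_of_inner_eq_zero _ _ this

/-- With p the projection of `U`, the operator representing pv + (1-p)w is block diagonal: its two
blocks have orthogonal initial spaces and orthogonal ranges, so its norm is at most the larger of
the two. -/
theorem IsRepresentable.norm_add_le_max {V : Type u} [NormedAddCommGroup V] [NormedSpace ℂ V]
    [Module C V] [Module Cᵐᵒᵖ V] [IsCentralScalar C V] (h : IsRepresentable C V)
    (U : Clopens (characterSpace ℂ C)) {v w : V} {r : ℝ} (hv : ‖v‖ ≤ r) (hw : ‖w‖ ≤ r) :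
    ‖clopenProj U • v + (1 - clopenProj U) • w‖ ≤ r := by
  obtain ⟨K, _, _, _, L, _, _, _, π, σ, J, hl, hr⟩ := h
  have hr0 : 0 ≤ r := (norm_nonneg v).trans hv
  -- Centrality allows one factor of p = p² to act on the right, so that p compresses the operator
  -- from both sides.
  have hJ : ∀ (W : Clopens (characterSpace ℂ C)) (v : V) (ξ : L),
      J (clopenProj W • v) ξ = π (clopenProj W) (J v (σ (clopenProj W) ξ)) := fun W v ξ => by
    conv_lhs => rw [← clopenProj_mul_self, mul_smul, hl, ← op_smul_eq_smul, hr]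
    rfl
  rw [← J.norm_map]
  refine ContinuousLinearMap.opNorm_le_bound _ hr0 fun ξ => ?_
  rw [map_add, one_sub_clopenProj, add_apply, hJ, hJ, ← one_sub_clopenProj]
  refine le_of_sq_le_sq ?_ (by positivity)
  have hξ := norm_sq_add_of_isProj σ U ξ ξ
  have e : σ (clopenProj U) ξ + σ (1 - clopenProj U) ξ = ξ := by
    rw [← add_apply, ← map_add, add_sub_cancel, map_one]
    rfl
  rw [e] at hξ
  have bound : ∀ (W : Clopens (characterSpace ℂ C)) (v : V), ‖v‖ ≤ r → ∀ ζ : L,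
      ‖π (clopenProj W) (J v ζ)‖ ^ 2 ≤ r ^ 2 * ‖ζ‖ ^ 2 := fun W v hv ζ => by
    rw [← mul_pow]
    refine pow_le_pow_left₀ (norm_nonneg _) ?_ 2
    have h1 : ‖π (clopenProj W)‖ ≤ 1 :=
      (NonUnitalStarAlgHom.norm_apply_le π _).trans (norm_clopenProj_le W)
    calc _ ≤ 1 * ‖J v ζ‖ := (π (clopenProj W)).le_of_opNorm_le h1 _
      _ = ‖J v ζ‖ := one_mul _
      _ ≤ _ := (J v).le_of_opNorm_le (by rwa [J.norm_map]) ζ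
  rw [norm_sq_add_of_isProj, mul_pow, hξ, mul_add]
  refine add_le_add (bound _ _ hv _) ?_
  rw [one_sub_clopenProj]
  exact bound _ _ hw _

end Central

/-! ### The projective seminorm over `C` -/

section GammaC

variable {C : Type u} [CommCStarAlgebra C]
variable {X : Type u} [NormedAddCommGroup X] [NormedSpace ℂ X]
  [Module C X] [IsScalarTower ℂ C X] [IsBoundedSMul C X]
  [Module Cᵐᵒᵖ X] [IsCentralScalar C X]
variable {Y : Type u} [NormedAddCommGroup Y] [NormedSpace ℂ Y]
  [Module C Y] [IsScalarTower ℂ C Y] [IsBoundedSMul C Y]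
  [Module Cᵐᵒᵖ Y] [IsCentralScalar C Y]

theorem gammaNorm_tmul_le {R : Type*} [CommRing R] {E F : Type u} [NormedAddCommGroup E]
    [Module R E] [NormedAddCommGroup F] [Module R F] (x : E) (y : F) :
    gammaNorm (x ⊗ₜ[R] y) ≤ ‖x‖ * ‖y‖ := by
  simpa using gammaNorm_le (R := R) (fun _ : Fin 1 => x) (fun _ => y)

theorem norm_le_mul_gammaNorm {R : Type*} [CommRing R] {E F : Type u} [NormedAddCommGroup E]
    [Module R E] [NormedAddCommGroup F] [Module R F] {G : Type*} [SeminormedAddCommGroup G]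
    (f : E ⊗[R] F →+ G) {A : ℝ} (hA : 0 ≤ A) (hf : ∀ x y, ‖f (x ⊗ₜ y)‖ ≤ A * (‖x‖ * ‖y‖))
    (w : E ⊗[R] F) : ‖f w‖ ≤ A * gammaNorm w := by
  have key : ∀ (n : ℕ) (x : Fin n → E) (y : Fin n → F), w = ∑ j, x j ⊗ₜ[R] y j →
      ‖f w‖ ≤ A * ∑ j, ‖x j‖ * ‖y j‖ := fun n x y hw => by
    rw [hw, map_sum, Finset.mul_sum]
    exact (norm_sum_le _ _).trans (Finset.sum_le_sum fun j _ => hf _ _)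
  rcases hA.eq_or_lt with rfl | hA
  · obtain ⟨n, x, y, hw⟩ := exists_rep w
    simpa using key n x y hw
  · rw [← div_le_iff₀' hA]
    refine le_gammaNorm fun n x y hw => ?_
    rw [div_le_iff₀' hA]
    exact key n x y hw

theorem exists_unimodular_mul_eq_norm (z : ℂ) : ∃ u : ℂ, ‖u‖ ≤ 1 ∧ u * z = ‖z‖ := by
  rcases eq_or_ne z 0 with rfl | hz
  · exact ⟨0, by simp, by simp⟩
  · refine ⟨‖z‖ / z, by simp [hz], by field_simp⟩

/-- Let f be a norming functional for w. On elementary tensors the functionals f(p ·) and f((1-p) ·)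
have norms adding up to at most 1, so f(w) is dominated by a convex combination of the two
seminorms. -/
theorem gammaNorm_le_max (hX : IsRepresentable C X) (hY : IsRepresentable C Y)
    (U : Clopens (characterSpace ℂ C)) (w : X ⊗[C] Y) :
    gammaNorm w ≤ max (gammaNorm (clopenProj U • w)) (gammaNorm ((1 - clopenProj U) • w)) := by
  set p : C := clopenProj U with hp
  set m := max (gammaNorm (p • w)) (gammaNorm ((1 - p) • w)) with hm
  obtain ⟨f, hf1, hfw⟩ := exists_dual_vector'' ℂ (show GammaPre C X Y from w)
  have hf : ∀ x y, ‖f (show GammaPre C X Y from x ⊗ₜ[C] y)‖ ≤ ‖x‖ * ‖y‖ := fun x y =>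
    (f.le_of_opNorm_le hf1 _).trans (by rw [one_mul]; exact gammaNorm_tmul_le x y)
  let F : C → X ⊗[C] Y →+ ℂ := fun c =>
    (f : GammaPre C X Y →ₗ[ℂ] ℂ).toAddMonoidHom.comp (DistribSMul.toAddMonoidHom (X ⊗[C] Y) c)
  have hF : ∀ c w, F c w = f (show GammaPre C X Y from c • w) := fun c w => rfl
  have hpp : p * p = p := clopenProj_mul_self U
  have hqq : (1 - p) * (1 - p) = 1 - p := by rw [hp, one_sub_clopenProj, clopenProj_mul_self]
  have hpq : p * (1 - p) = 0 := by rw [mul_sub, hpp, mul_one, sub_self]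
  -- Test f on a single elementary tensor of block sums, whose factors lie in the unit balls by
  -- `norm_add_le_max`. The cross terms vanish because p(1-p) = 0, and the scalars u, u' rotate the
  -- two remaining values onto the positive axis so that they add without cancellation.
  have main : ∀ x y x' y', ‖x‖ ≤ 1 → ‖y‖ ≤ 1 → ‖x'‖ ≤ 1 → ‖y'‖ ≤ 1 →
      ‖F p (x ⊗ₜ y)‖ + ‖F (1 - p) (x' ⊗ₜ y')‖ ≤ 1 := by
    intro x y x' y' hx hy hx' hy'
    obtain ⟨u, hu, hue⟩ := exists_unimodular_mul_eq_norm (F p (x ⊗ₜ y))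
    obtain ⟨u', hu', hue'⟩ := exists_unimodular_mul_eq_norm (F (1 - p) (x' ⊗ₜ y'))
    have h1 : ‖p • (u • x) + (1 - p) • (u' • x')‖ ≤ 1 := hX.norm_add_le_max U
      ((norm_smul_le _ _).trans (mul_le_one₀ hu (norm_nonneg _) hx))
      ((norm_smul_le _ _).trans (mul_le_one₀ hu' (norm_nonneg _) hx'))
    have h2 : ‖p • y + (1 - p) • y'‖ ≤ 1 := hY.norm_add_le_max U hy hy'
    have h3 := (hf _ _).trans (mul_le_one₀ h1 (norm_nonneg _) h2)
    have e : (p • (u • x) + (1 - p) • (u' • x')) ⊗ₜ[C] (p • y + (1 - p) • y') =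
        u • (p • x ⊗ₜ[C] y) + u' • ((1 - p) • x' ⊗ₜ[C] y') := by
      simp only [TensorProduct.add_tmul, TensorProduct.tmul_add, ← TensorProduct.smul_tmul',
        TensorProduct.tmul_smul]
      rw [smul_add, smul_add (1 - p), smul_smul p p, smul_smul p (1 - p), smul_smul (1 - p) p, smul_smul (1 - p) (1 - p),
        mul_comm (1 - p) p, hpp, hqq, hpq, zero_smul, zero_smul, add_zero, zero_add,
        smul_comm u, smul_comm u']
    rw [e] at h3
    have e2 : f (show GammaPre C X Y from u • (p • x ⊗ₜ[C] y) + u' • ((1 - p) • x' ⊗ₜ[C] y')) =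
        u * F p (x ⊗ₜ y) + u' * F (1 - p) (x' ⊗ₜ y') := by
      rw [hF, hF, ← smul_eq_mul, ← smul_eq_mul, ← map_smul, ← map_smul, ← map_add]
      rfl
    rw [e2, hue, hue', ← Complex.ofReal_add, Complex.norm_real, Real.norm_of_nonneg
      (by positivity)] at h3
    exact h3
  have homog : ∀ (c : C) (A : ℝ), (∀ x y, ‖x‖ ≤ 1 → ‖y‖ ≤ 1 → ‖F c (x ⊗ₜ y)‖ ≤ A) →
      ∀ x y, ‖F c (x ⊗ₜ y)‖ ≤ A * (‖x‖ * ‖y‖) := by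
    intro c A hA x y
    rcases eq_or_ne x 0 with rfl | hx
    · simp
    rcases eq_or_ne y 0 with rfl | hy
    · simp
    have hx' : 0 < ‖x‖ := norm_pos_iff.2 hx
    have hy' : 0 < ‖y‖ := norm_pos_iff.2 hy
    have := hA (((‖x‖⁻¹ : ℝ) : ℂ) • x) (((‖y‖⁻¹ : ℝ) : ℂ) • y)
      (by rw [norm_smul, Complex.norm_real]; simp [hx'.ne'])
      (by rw [norm_smul, Complex.norm_real]; simp [hy'.ne'])
    have e : F c ((((‖x‖⁻¹ : ℝ) : ℂ) • x) ⊗ₜ[C] (((‖y‖⁻¹ : ℝ) : ℂ) • y)) =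
        (((‖x‖⁻¹ : ℝ) : ℂ) * ((‖y‖⁻¹ : ℝ) : ℂ)) * F c (x ⊗ₜ y) := by
      rw [hF, hF, ← smul_eq_mul (_ * _), ← map_smul, mul_smul]
      congr 1
      change c • _ = ((‖x‖⁻¹ : ℝ) : ℂ) • ((‖y‖⁻¹ : ℝ) : ℂ) • c • (x ⊗ₜ[C] y)
      rw [TensorProduct.tmul_smul, ← TensorProduct.smul_tmul', smul_comm c, smul_comm c, smul_comm]
    rw [e, norm_mul, norm_mul, Complex.norm_real, Complex.norm_real, norm_inv, norm_inv,
      norm_norm, norm_norm] at this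
    calc ‖F c (x ⊗ₜ y)‖ = (‖x‖⁻¹ * ‖y‖⁻¹ * ‖F c (x ⊗ₜ y)‖) * (‖x‖ * ‖y‖) := by field_simp
      _ ≤ _ := mul_le_mul_of_nonneg_right this (by positivity)
  set S : Set ℝ := {r | ∃ x y, ‖x‖ ≤ 1 ∧ ‖y‖ ≤ 1 ∧ r = ‖F p (x ⊗ₜ y)‖} with hS
  have hS1 : ∀ r ∈ S, r ≤ 1 := by
    rintro r ⟨x, y, hx, hy, rfl⟩
    simpa using main x y 0 0 hx hy (by simp) (by simp)
  set A := sSup S with hA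
  have hS0 : (0 : ℝ) ∈ S := ⟨0, 0, by simp, by simp, by simp⟩
  have hA0 : 0 ≤ A := le_csSup ⟨1, hS1⟩ hS0
  have hA1 : A ≤ 1 := csSup_le ⟨0, hS0⟩ hS1
  have hp1 := norm_le_mul_gammaNorm (F p) hA0
    (homog p A fun x y hx hy => le_csSup ⟨1, hS1⟩ ⟨x, y, hx, hy, rfl⟩) (p • w)
  have hq1 := norm_le_mul_gammaNorm (F (1 - p)) (sub_nonneg.2 hA1)
    (homog (1 - p) (1 - A) fun x' y' hx' hy' => by
      rw [le_sub_comm]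
      refine csSup_le ⟨0, hS0⟩ ?_
      rintro r ⟨x, y, hx, hy, rfl⟩
      exact le_sub_iff_add_le.2 (main x y x' y' hx hy hx' hy')) ((1 - p) • w)
  -- The weights are A, the supremum of |f(p ·)| over tensors of unit vectors, and 1 - A, which
  -- bounds |f((1-p) ·)| on such tensors by `main`.
  have e : f (show GammaPre C X Y from w) = F p (p • w) + F (1 - p) ((1 - p) • w) := by
    rw [hF, hF, smul_smul, smul_smul, hpp, hqq, ← map_add]
    congr 1
    change w = p • w + (1 - p) • w
    rw [← add_smul, add_sub_cancel, one_smul]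
  have hw : ‖f (show GammaPre C X Y from w)‖ = gammaNorm w := by
    rw [hfw]
    exact (Complex.norm_real _).trans (norm_norm (show GammaPre C X Y from w))
  rw [← hw, e]
  calc _ ≤ A * m + (1 - A) * m := (norm_add_le _ _).trans (add_le_add
        (hp1.trans (mul_le_mul_of_nonneg_left (le_max_left _ _) hA0))
        (hq1.trans (mul_le_mul_of_nonneg_left (le_max_right _ _) (sub_nonneg.2 hA1))))
    _ = m := by ring

end GammaC

end CentralModule

end

noncomputable section

namespace CentralModule

open Filter Set TopologicalSpace

/-! ### Localization at a point of the spectrum -/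

section Localization

variable {C : Type u} [CommCStarAlgebra C]

/-- `m` becomes arbitrarily small on clopen neighbourhoods of `t`. -/
def LocallyNull {M : Type*} [SeminormedAddCommGroup M] [Module C M] (t : characterSpace ℂ C)
    (m : M) : Prop :=
  ∀ ε > 0, ∃ V : Clopens (characterSpace ℂ C), t ∈ V ∧ ‖clopenProj V • m‖ < ε

section

variable {M : Type*} [SeminormedAddCommGroup M] [Module C M] [IsBoundedSMul C M]
  {t : characterSpace ℂ C}

theorem norm_clopenProj_smul_le (V : Clopens (characterSpace ℂ C)) (m : M) :
    ‖clopenProj V • m‖ ≤ ‖m‖ :=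
  (norm_smul_le _ _).trans (mul_le_of_le_one_left (norm_nonneg _) (norm_clopenProj_le V))

theorem norm_clopenProj_smul_mono {V W : Clopens (characterSpace ℂ C)} (h : V ≤ W) (m : M) :
    ‖clopenProj V • m‖ ≤ ‖clopenProj W • m‖ := by
  rw [← clopenProj_mul_of_le h, mul_smul]
  exact norm_clopenProj_smul_le V _

theorem LocallyNull.zero : LocallyNull t (0 : M) := fun ε hε =>
  ⟨⊤, mem_univ t, by simpa using hε⟩

theorem LocallyNull.add {m n : M} (hm : LocallyNull t m) (hn : LocallyNull t n) :
    LocallyNull t (m + n) := by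
  intro ε hε
  obtain ⟨V, hV, hVm⟩ := hm (ε / 2) (half_pos hε)
  obtain ⟨W, hW, hWn⟩ := hn (ε / 2) (half_pos hε)
  refine ⟨V ⊓ W, ⟨hV, hW⟩, ?_⟩
  rw [smul_add]
  calc _ ≤ ‖clopenProj (V ⊓ W) • m‖ + ‖clopenProj (V ⊓ W) • n‖ := norm_add_le _ _
    _ ≤ ‖clopenProj V • m‖ + ‖clopenProj W • n‖ := add_le_add
      (norm_clopenProj_smul_mono inf_le_left m) (norm_clopenProj_smul_mono inf_le_right n)
    _ < ε := by linarith

theorem LocallyNull.of_forall_norm_sub_lt {m : M}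
    (h : ∀ ε > 0, ∃ n, ‖m - n‖ < ε ∧ LocallyNull t n) : LocallyNull t m := by
  intro ε hε
  obtain ⟨n, hn, hnl⟩ := h (ε / 2) (half_pos hε)
  obtain ⟨V, hV, hVn⟩ := hnl (ε / 2) (half_pos hε)
  refine ⟨V, hV, ?_⟩
  calc _ = ‖clopenProj V • (m - n) + clopenProj V • n‖ := by rw [← smul_add, sub_add_cancel]
    _ ≤ ‖m - n‖ + ‖clopenProj V • n‖ :=
      (norm_add_le _ _).trans (add_le_add_left (norm_clopenProj_smul_le V _) _)
    _ < ε := by linarith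

theorem LocallyNull.of_norm_le {N : Type*} [SeminormedAddCommGroup N] [Module C N]
    {m : M} {n : N} (hm : LocallyNull t m) {a : ℝ} (ha : 0 ≤ a)
    (h : ∀ V : Clopens (characterSpace ℂ C), ‖clopenProj V • n‖ ≤ a * ‖clopenProj V • m‖) :
    LocallyNull t n := by
  intro ε hε
  -- The denominator is `a + 1` because `a` may be 0.
  obtain ⟨V, hV, hVm⟩ := hm (ε / (a + 1)) (by positivity)
  refine ⟨V, hV, (h V).trans_lt ?_⟩
  rw [lt_div_iff₀ (by positivity)] at hVm
  nlinarith [norm_nonneg (clopenProj V • m)]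

theorem locallyNull_of_character_eq_zero [ExtremallyDisconnected (characterSpace ℂ C)] {c : C}
    (hc : t c = 0) : LocallyNull t c := by
  intro ε hε
  obtain ⟨V, hV, hVc⟩ := exists_clopen_subset (t := t)
    (isOpen_lt (continuous_character c).norm continuous_const) (show ‖t c‖ < ε / 2 by
      rw [hc, norm_zero]; exact half_pos hε)
  refine ⟨V, hV, lt_of_le_of_lt ?_ (half_lt_self hε)⟩
  refine norm_le_of_forall_character (half_pos hε).le fun s => ?_
  rw [smul_eq_mul, map_mul]
  by_cases hs : s ∈ V
  · rw [character_clopenProj_of_mem hs, one_mul]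
    exact le_of_lt (hVc hs)
  · rw [character_clopenProj_of_notMem hs, zero_mul, norm_zero]
    exact (half_pos hε).le

end

/-- A coefficient `c` vanishing at `t` is uniformly small on a clopen neighbourhood, and so is `c •
x`. Sums are handled by intersecting neighbourhoods, and limits by contractivity of the projections.
-/
theorem locallyNull_of_mem_fiberKer [ExtremallyDisconnected (characterSpace ℂ C)]
    {t : characterSpace ℂ C} {X : Type u} [NormedAddCommGroup X] [NormedSpace ℂ X]
    [Module C X] [IsScalarTower ℂ C X] [IsBoundedSMul C X] {x : X} (hx : x ∈ fiberKer t X) :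
    LocallyNull t x := by
  have hspan : ∀ y ∈ Submodule.span ℂ {z : X | ∃ (c : C) (x : X), t c = 0 ∧ z = c • x},
      LocallyNull t y := fun y hy => by
    induction hy using Submodule.span_induction with
    | mem y hy =>
      obtain ⟨c, x, hc, rfl⟩ := hy
      refine (locallyNull_of_character_eq_zero hc).of_norm_le (norm_nonneg x) fun V => ?_
      rw [smul_smul, mul_comm ‖x‖]
      exact norm_smul_le _ _
    | zero => exact LocallyNull.zero
    | add y z _ _ hy hz => exact hy.add hz
    | smul a y _ hy =>
      refine hy.of_norm_le (norm_nonneg a) fun V => ?_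
      rw [smul_comm]
      exact norm_smul_le _ _
  refine LocallyNull.of_forall_norm_sub_lt fun ε hε => ?_
  obtain ⟨y, hy, hxy⟩ := Metric.mem_closure_iff.1 hx ε hε
  exact ⟨y, by rwa [← dist_eq_norm], hspan y hy⟩

end Localization

/-! ### The fibres of the tensor product -/

section FiberMap

variable {C : Type u} [CommCStarAlgebra C]
variable {X : Type u} [NormedAddCommGroup X] [NormedSpace ℂ X] [Module C X] [IsScalarTower ℂ C X]
variable {Y : Type u} [NormedAddCommGroup Y] [NormedSpace ℂ Y] [Module C Y] [IsScalarTower ℂ C Y]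
variable (t : characterSpace ℂ C)

theorem Fiber.mk_smul (c : C) (x : X) : Fiber.mk t (c • x) = t c • Fiber.mk t x := by
  unfold Fiber.mk
  rw [← map_smul, ← sub_eq_zero, ← map_sub]
  -- The element c - t(c)1 lies in the kernel of `t`.
  refine (Submodule.Quotient.mk_eq_zero _).2
    (Submodule.le_topologicalClosure _ (Submodule.subset_span ⟨c - algebraMap ℂ C (t c), x, ?_, ?_⟩))
  · rw [map_sub, AlgHomClass.commutes]
    simp
  · rw [sub_smul, algebraMap_smul]

/-- The map `x ⊗ y ↦ x(t) ⊗ y(t)`. -/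
def fiberMap : X ⊗[C] Y →ₗ[ℂ] Fiber t X ⊗[ℂ] Fiber t Y where
  toFun := TensorProduct.liftAddHom
    (AddMonoidHom.mk' (fun x : X => AddMonoidHom.mk' (fun y : Y => Fiber.mk t x ⊗ₜ[ℂ] Fiber.mk t y)
      fun y y' => by simp [Fiber.mk, TensorProduct.tmul_add])
      fun x x' => by ext y; simp [Fiber.mk, TensorProduct.add_tmul])
    (fun c x y => by
      change Fiber.mk t (c • x) ⊗ₜ[ℂ] Fiber.mk t y = Fiber.mk t x ⊗ₜ[ℂ] Fiber.mk t (c • y)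
      rw [Fiber.mk_smul, Fiber.mk_smul, TensorProduct.smul_tmul])
  map_add' := map_add _
  map_smul' z w := by
    induction w with
    | zero => simp
    | tmul x y =>
      rw [TensorProduct.smul_tmul', TensorProduct.liftAddHom_tmul, TensorProduct.liftAddHom_tmul]
      simp [Fiber.mk, TensorProduct.smul_tmul']
    | add v w hv hw => simp only [smul_add, map_add, hv, hw]

@[simp]
theorem fiberMap_tmul (x : X) (y : Y) :
    fiberMap t (x ⊗ₜ[C] y) = Fiber.mk t x ⊗ₜ[ℂ] Fiber.mk t y := rfl

theorem fiberMap_smul (c : C) (w : X ⊗[C] Y) : fiberMap t (c • w) = t c • fiberMap t w := by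
  induction w with
  | zero => simp
  | tmul x y => rw [TensorProduct.smul_tmul', fiberMap_tmul, fiberMap_tmul, Fiber.mk_smul,
      TensorProduct.smul_tmul']
  | add v w hv hw => rw [smul_add, map_add, map_add, smul_add, hv, hw]

theorem gammaNorm_fiberMap_le (w : X ⊗[C] Y) : gammaNorm (fiberMap t w) ≤ gammaNorm w := by
  refine le_gammaNorm fun n x y hw => ?_
  have := gammaNorm_le (R := ℂ) (fun j => Fiber.mk t (x j)) (fun j => Fiber.mk t (y j))
  rw [hw, map_sum]
  refine this.trans (Finset.sum_le_sum fun j _ => ?_)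
  exact mul_le_mul (Fiber.norm_mk_le t _) (Fiber.norm_mk_le t _) (norm_nonneg _) (norm_nonneg _)

variable [IsBoundedSMul C X] [IsBoundedSMul C Y]

/-- By right exactness, the kernel of a tensor product of two quotient maps is spanned by tensors
with one factor in a kernel. Such a factor is locally null, and the projective seminorm of the
tensor inherits this. -/
theorem locallyNull_of_fiberMap_eq_zero [ExtremallyDisconnected (characterSpace ℂ C)]
    {t : characterSpace ℂ C} {w : X ⊗[C] Y} (hw : fiberMap t w = 0) :
    LocallyNull t (show GammaPre C X Y from w) := by
  -- Lift to the tensor product over ℂ, the ring over which the two fibre quotient maps are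
  -- tensored.
  obtain ⟨v, rfl⟩ := TensorProduct.mapOfCompatibleSMul_surjective C ℂ ℂ X Y w
  set ψ := TensorProduct.mapOfCompatibleSMul C ℂ ℂ X Y
  have hψ : ∀ v, fiberMap t (ψ v) =
      TensorProduct.map (fiberKer t X).mkQ (fiberKer t Y).mkQ v := fun v => by
    induction v with
    | zero => simp
    | tmul x y => rfl
    | add v w hv hw => simp only [map_add, hv, hw]
  have hv : v ∈ LinearMap.ker (TensorProduct.map (fiberKer t X).mkQ (fiberKer t Y).mkQ) := by
    rw [LinearMap.mem_ker, ← hψ, hw]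
  rw [TensorProduct.map_ker (LinearMap.exact_subtype_mkQ (fiberKer t X))
    (Submodule.mkQ_surjective _) (LinearMap.exact_subtype_mkQ (fiberKer t Y))
    (Submodule.mkQ_surjective _), Submodule.mem_sup] at hv
  have bound : ∀ (c : C) (x : X) (y : Y),
      ‖c • (show GammaPre C X Y from x ⊗ₜ[C] y)‖ ≤ ‖y‖ * ‖c • x‖ ∧
      ‖c • (show GammaPre C X Y from x ⊗ₜ[C] y)‖ ≤ ‖x‖ * ‖c • y‖ := fun c x y => by
    constructor
    · change gammaNorm (c • x ⊗ₜ[C] y) ≤ _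
      rw [TensorProduct.smul_tmul', mul_comm]
      exact gammaNorm_tmul_le _ _
    · change gammaNorm (c • x ⊗ₜ[C] y) ≤ _
      rw [← TensorProduct.tmul_smul]
      exact gammaNorm_tmul_le _ _
  obtain ⟨_, ⟨a, rfl⟩, _, ⟨b, rfl⟩, rfl⟩ := hv
  clear hw
  rw [map_add]
  refine LocallyNull.add (M := GammaPre C X Y) ?_ ?_
  · induction a with
    | zero => rw [map_zero, map_zero]; exact LocallyNull.zero (M := GammaPre C X Y)
    | tmul x u =>
      exact (locallyNull_of_mem_fiberKer u.2).of_norm_le (norm_nonneg x)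
        fun V => (bound _ _ _).2
    | add a b ha hb => rw [map_add, map_add]; exact LocallyNull.add (M := GammaPre C X Y) ha hb
  · induction b with
    | zero => rw [map_zero, map_zero]; exact LocallyNull.zero (M := GammaPre C X Y)
    | tmul u y =>
      exact (locallyNull_of_mem_fiberKer u.2).of_norm_le (norm_nonneg y)
        fun V => (bound _ _ _).1
    | add a b ha hb => rw [map_add, map_add]; exact LocallyNull.add (M := GammaPre C X Y) ha hb

theorem exists_rep_lt {R : Type*} [CommRing R] {E F : Type u} [NormedAddCommGroup E]
    [Module R E] [NormedAddCommGroup F] [Module R F] {w : E ⊗[R] F} {r : ℝ}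
    (h : gammaNorm w < r) : ∃ (n : ℕ) (x : Fin n → E) (y : Fin n → F),
      w = ∑ j, x j ⊗ₜ[R] y j ∧ ∑ j, ‖x j‖ * ‖y j‖ < r := by
  by_contra! hn
  exact absurd h (not_lt.2 (le_gammaNorm hn))

/-- A nearly optimal representation of w(t) lifts to a tensor w' over `C` with γ_C(w') < r. The
difference w - w' vanishes in the fibre at `t`, so it is small on a clopen neighbourhood. -/
theorem exists_clopen_gammaNorm_lt [ExtremallyDisconnected (characterSpace ℂ C)]
    {t : characterSpace ℂ C} {w : X ⊗[C] Y} {r : ℝ} (hw : gammaNorm (fiberMap t w) < r) :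
    ∃ V : Clopens (characterSpace ℂ C), t ∈ V ∧ gammaNorm (clopenProj V • w) < r := by
  obtain ⟨n, a, b, hab, hr⟩ := exists_rep_lt hw
  -- Quotient norms are attained only up to δ. By continuity at 0, some δ > 0 keeps the total cost
  -- of the lifts below `r`.
  have hcont : Tendsto (fun δ : ℝ => ∑ j, (‖a j‖ + δ) * (‖b j‖ + δ)) (𝓝[>] 0)
      (𝓝 (∑ j, (‖a j‖ + 0) * (‖b j‖ + 0))) :=
    Continuous.tendsto' (by fun_prop) _ _ rfl |>.mono_left nhdsWithin_le_nhds
  simp only [add_zero] at hcont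
  obtain ⟨δ, hδ, hδ0⟩ := ((hcont.eventually (gt_mem_nhds hr)).and self_mem_nhdsWithin).exists
  have hδ0 : 0 < δ := hδ0
  choose x hx hxn using fun j => Submodule.Quotient.norm_mk_lt (a j) hδ0
  choose y hy hyn using fun j => Submodule.Quotient.norm_mk_lt (b j) hδ0
  set w' := ∑ j, x j ⊗ₜ[C] y j with hw'
  have hw'r : gammaNorm w' < r := by
    refine ((gammaNorm_le x y).trans (Finset.sum_le_sum fun j _ => ?_)).trans_lt hδ
    exact mul_le_mul (hxn j).le (hyn j).le (norm_nonneg _) (by positivity)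
  have hdiff : fiberMap t (w - w') = 0 := by
    rw [map_sub, hab, hw', map_sum, sub_eq_zero]
    refine Finset.sum_congr rfl fun j _ => ?_
    rw [fiberMap_tmul, ← hx j, ← hy j]
    rfl
  obtain ⟨V, hV, hVd⟩ := locallyNull_of_fiberMap_eq_zero hdiff (r - gammaNorm w')
    (sub_pos.2 hw'r)
  refine ⟨V, hV, ?_⟩
  have h1 : gammaNorm (clopenProj V • (w - w')) < r - gammaNorm w' := hVd
  have h2 : gammaNorm (clopenProj V • w') ≤ gammaNorm w' :=
    norm_clopenProj_smul_le (M := GammaPre C X Y) V w'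
  have h3 := gammaNorm_add_le (clopenProj V • (w - w')) (clopenProj V • w')
  rw [← smul_add, sub_add_cancel] at h3
  linarith

theorem isOpen_gammaNorm_fiberMap_lt [ExtremallyDisconnected (characterSpace ℂ C)]
    (w : X ⊗[C] Y) (r : ℝ) : IsOpen {t : characterSpace ℂ C | gammaNorm (fiberMap t w) < r} := by
  rw [isOpen_iff_mem_nhds]
  intro t ht
  obtain ⟨V, hV, hVw⟩ := exists_clopen_gammaNorm_lt ht
  -- For s in V the tensors w and pw have the same fibre at s, where p is the projection of V.
  filter_upwards [V.isClopen.isOpen.mem_nhds hV] with s hs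
  have := gammaNorm_fiberMap_le s (clopenProj V • w)
  rw [fiberMap_smul, character_clopenProj_of_mem hs, one_smul] at this
  exact this.trans_lt hVw

variable [Module Cᵐᵒᵖ X] [IsCentralScalar C X] [Module Cᵐᵒᵖ Y] [IsCentralScalar C Y]

/-- The strict inequality at each point spreads to a clopen neighbourhood. The class of sets covered
by a clopen set with the bound `r` is stable under finite unions, so compactness reaches the whole
spectrum. -/
theorem gammaNorm_le_of_fiberMap_lt [ExtremallyDisconnected (characterSpace ℂ C)]
    (hX : IsRepresentable C X) (hY : IsRepresentable C Y) {w : X ⊗[C] Y} {r : ℝ} (hr : 0 ≤ r)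
    (hw : ∀ t : characterSpace ℂ C, gammaNorm (fiberMap t w) < r) : gammaNorm w ≤ r := by
  have mono : ∀ {V W : Clopens (characterSpace ℂ C)}, V ≤ W →
      gammaNorm (clopenProj V • w) ≤ gammaNorm (clopenProj W • w) := fun h =>
    norm_clopenProj_smul_mono (M := GammaPre C X Y) h w
  have key : ∃ V : Clopens (characterSpace ℂ C), univ ⊆ (V : Set (characterSpace ℂ C)) ∧
      gammaNorm (clopenProj V • w) ≤ r := by
    refine isCompact_univ.induction_on (p := fun S => ∃ V : Clopens (characterSpace ℂ C),
      S ⊆ (V : Set (characterSpace ℂ C)) ∧ gammaNorm (clopenProj V • w) ≤ r) ?_ ?_ ?_ ?_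
    · refine ⟨⊥, empty_subset _, ?_⟩
      have : clopenProj (⊥ : Clopens (characterSpace ℂ C)) = 0 := eq_of_forall_character fun t => by
        rw [character_clopenProj_of_notMem (show t ∉ (⊥ : Clopens (characterSpace ℂ C)) from
          notMem_empty t), map_zero]
      rw [this, zero_smul, gammaNorm_zero]
      exact hr
    · rintro S T hST ⟨V, h1, h2⟩
      exact ⟨V, hST.trans h1, h2⟩
    · rintro S T ⟨V, h1, h2⟩ ⟨W, h3, h4⟩
      -- Cutting the union by V leaves a part of V and the part of W outside V; both are controlled
      -- by monotonicity.
      refine ⟨V ⊔ W, union_subset_union h1 h3, (gammaNorm_le_max hX hY V _).trans (max_le ?_ ?_)⟩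
      · rw [smul_smul, ← clopenProj_inf]
        exact (mono inf_le_left).trans h2
      · rw [one_sub_clopenProj, smul_smul, ← clopenProj_inf]
        refine (mono ?_).trans h4
        rw [inf_sup_left, compl_inf_self, bot_sup_eq]
        exact inf_le_right
    · intro t _
      obtain ⟨V, hV, hVw⟩ := exists_clopen_gammaNorm_lt (hw t)
      exact ⟨V, mem_nhdsWithin_of_mem_nhds (V.isClopen.isOpen.mem_nhds hV), V, subset_rfl, hVw.le⟩
  obtain ⟨V, hV, hVw⟩ := key
  have : V = ⊤ := Clopens.ext (univ_subset_iff.1 hV)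
  rwa [this, clopenProj_top, one_smul] at hVw

/-- The projective seminorm over `C` is the supremum of the projective norms of the fibres. -/
theorem gammaNorm_le_of_fiberMap_le [ExtremallyDisconnected (characterSpace ℂ C)]
    (hX : IsRepresentable C X) (hY : IsRepresentable C Y) {w : X ⊗[C] Y} {r : ℝ} (hr : 0 ≤ r)
    (hw : ∀ t : characterSpace ℂ C, gammaNorm (fiberMap t w) ≤ r) : gammaNorm w ≤ r :=
  le_of_forall_pos_le_add fun ε hε => gammaNorm_le_of_fiberMap_lt hX hY (by positivity)
    fun t => (hw t).trans_lt (by linarith)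

end FiberMap

end CentralModule

end

noncomputable section

namespace CentralModule

open Filter Set TopologicalSpace

/-! ### Weak* convergence of projections -/

section Normality

variable {C : Type u} [CommCStarAlgebra C]
variable {H : Type u} [NormedAddCommGroup H] [InnerProductSpace ℂ H] [CompleteSpace H]
variable {ρ : C →⋆ₐ[ℂ] (H →L[ℂ] H)}

instance clopensBelow_isDirectedOrder (U : Set (characterSpace ℂ C)) :
    IsDirectedOrder {V : Clopens (characterSpace ℂ C) // (V : Set (characterSpace ℂ C)) ⊆ U} :=
  ⟨fun a b => ⟨⟨a.1 ⊔ b.1, union_subset a.2 b.2⟩,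
    show a.1 ≤ a.1 ⊔ b.1 from le_sup_left, show b.1 ≤ a.1 ⊔ b.1 from le_sup_right⟩⟩

instance clopensBelow_nonempty (U : Set (characterSpace ℂ C)) :
    Nonempty {V : Clopens (characterSpace ℂ C) // (V : Set (characterSpace ℂ C)) ⊆ U} :=
  ⟨⟨⊥, empty_subset U⟩⟩

theorem tendsto_clopenProj_mul [ExtremallyDisconnected (characterSpace ℂ C)]
    {U : Set (characterSpace ℂ C)} (hU : IsOpen U) {c : C} (hc : ∀ t ∉ U, t c = 0) :
    Tendsto (fun V : {V : Clopens (characterSpace ℂ C) // (V : Set (characterSpace ℂ C)) ⊆ U} =>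
      clopenProj V.1 * c) atTop (𝓝 c) := by
  refine Metric.tendsto_nhds.2 fun ε hε => ?_
  -- Where |c| ≥ ε/2 is a closed subset of `U`; any clopen set containing it makes the remainder of
  -- `c` at most ε/2.
  have hK : IsClosed {t : characterSpace ℂ C | ε / 2 ≤ ‖t c‖} :=
    isClosed_le continuous_const (continuous_character c).norm
  obtain ⟨V₀, h1, h2⟩ := exists_clopen_between hK hU fun t (ht : ε / 2 ≤ ‖t c‖) => by
    by_contra hn
    rw [hc t hn, norm_zero] at ht
    linarith
  filter_upwards [eventually_ge_atTop ⟨V₀, h2⟩] with V hV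
  rw [dist_eq_norm]
  refine lt_of_le_of_lt ?_ (half_lt_self hε)
  refine norm_le_of_forall_character (half_pos hε).le fun t => ?_
  rw [map_sub, map_mul]
  by_cases ht : t ∈ V.1
  · rw [character_clopenProj_of_mem ht, one_mul, sub_self, norm_zero]
    exact (half_pos hε).le
  · rw [character_clopenProj_of_notMem ht, zero_mul, zero_sub, norm_neg]
    by_contra! hn
    exact ht (hV (h1 hn.le))

theorem norm_rep_clopenProj_apply_le {K : Type*} [NormedAddCommGroup K] [InnerProductSpace ℂ K]
    [CompleteSpace K] (π : C →⋆ₐ[ℂ] (K →L[ℂ] K)) (V : Clopens (characterSpace ℂ C)) (x : K) :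
    ‖π (clopenProj V) x‖ ≤ ‖x‖ := by
  have h := (π (clopenProj V)).le_of_opNorm_le
    ((NonUnitalStarAlgHom.norm_apply_le π _).trans (norm_clopenProj_le V)) x
  rwa [one_mul] at h

/-- Strong convergence is clear on vectors `ρ c x` with `c` supported in `U`. These span a dense
subspace by `openRange_eq_top`, and the projections are uniformly bounded. -/
theorem tendsto_rep_clopenProj_apply (hρ : IsVonNeumann ρ)
    [ExtremallyDisconnected (characterSpace ℂ C)]
    {U : Set (characterSpace ℂ C)} (hU : IsOpen U) (hd : Dense U) (x : H) :
    Tendsto (fun V : {V : Clopens (characterSpace ℂ C) // (V : Set (characterSpace ℂ C)) ⊆ U} =>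
      ρ (clopenProj V.1) x) atTop (𝓝 x) := by
  have hspan : ∀ y ∈ Submodule.span ℂ {z : H | ∃ (c : C) (x : H), (∀ t ∉ U, t c = 0) ∧ z = ρ c x},
      Tendsto (fun V : {V : Clopens (characterSpace ℂ C) // (V : Set (characterSpace ℂ C)) ⊆ U} =>
        ρ (clopenProj V.1) y) atTop (𝓝 y) := fun y hy => by
    induction hy using Submodule.span_induction with
    | mem y hy =>
      obtain ⟨c, x, hc, rfl⟩ := hy
      have h1 : Continuous fun a : C => ρ a x :=
        (ContinuousLinearMap.apply ℂ H x).continuous.comp 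
          (AddMonoidHomClass.continuous_of_bound ρ 1 fun a => by
            simpa using NonUnitalStarAlgHom.norm_apply_le ρ a)
      have h2 := (h1.tendsto c).comp (tendsto_clopenProj_mul hU hc)
      refine h2.congr fun V => ?_
      simp [map_mul]
    | zero => simp
    | add y z _ _ hy hz => simpa only [map_add] using hy.add hz
    | smul a y _ hy => simpa only [map_smul] using hy.const_smul a
  have hx : x ∈ openRange ρ U := by
    rw [openRange_eq_top hρ hU hd]
    trivial
  refine Metric.tendsto_nhds.2 fun ε hε => ?_
  obtain ⟨y, hy, hxy⟩ := Metric.mem_closure_iff.1 hx (ε / 3) (by positivity)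
  filter_upwards [Metric.tendsto_nhds.1 (hspan y hy) (ε / 3) (by positivity)] with V h1
  have h2 : dist (ρ (clopenProj V.1) x) (ρ (clopenProj V.1) y) ≤ dist x y := by
    rw [dist_eq_norm, dist_eq_norm, ← map_sub]
    exact norm_rep_clopenProj_apply_le ρ _ _
  have h3 := dist_triangle4 (ρ (clopenProj V.1) x) (ρ (clopenProj V.1) y) y x
  rw [dist_comm y x] at h3
  linarith

theorem summable_norm_mul_norm {E : Type*} [NormedAddCommGroup E] {ι : Type*}
    (x y : lp (fun _ : ι => E) 2) : Summable fun n => ‖x n‖ * ‖y n‖ :=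
  lp.summable_mul (p := 2) (q := 2) (by norm_num; exact Real.HolderConjugate.two_two) x y

/-- Strong convergence of a bounded net passes to each functional Σ⟨η_n, T ξ_n⟩ by dominated
convergence, with dominating series Σ‖η_n‖‖ξ_n‖. -/
theorem tendsto_clopenProj_weakStar (hρ : IsVonNeumann ρ)
    [ExtremallyDisconnected (characterSpace ℂ C)]
    {U : Set (characterSpace ℂ C)} (hU : IsOpen U) (hd : Dense U) :
    Tendsto (fun V : {V : Clopens (characterSpace ℂ C) // (V : Set (characterSpace ℂ C)) ⊆ U} =>
      clopenProj V.1) atTop (@nhds C (weakStar ρ) 1) := by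
  rw [@nhds_induced _ _ (ultraweak H) ρ 1, tendsto_comap_iff, nhds_iInf, tendsto_iInf]
  intro p
  rw [nhds_induced, tendsto_comap_iff]
  refine tendsto_tsum_of_dominated_convergence (bound := fun n => ‖p.2 n‖ * ‖p.1 n‖)
    (summable_norm_mul_norm p.2 p.1) (fun n => ?_) (Eventually.of_forall fun V n => ?_)
  · rw [map_one]
    exact tendsto_const_nhds.inner (tendsto_rep_clopenProj_apply hρ hU hd (p.1 n))
  · exact (norm_inner_le_norm _ _).trans
      (mul_le_mul_of_nonneg_left (norm_rep_clopenProj_apply_le ρ _ _) (norm_nonneg _))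

end Normality

/-! ### The essential norm -/

section EssNorm

variable {C : Type u} [CommCStarAlgebra C]
variable {H : Type u} [NormedAddCommGroup H] [InnerProductSpace ℂ H] [CompleteSpace H]
variable {ρ : C →⋆ₐ[ℂ] (H →L[ℂ] H)}
variable {X : Type u} [NormedAddCommGroup X] [NormedSpace ℂ X] [Module C X] [IsScalarTower ℂ C X]
variable {Y : Type u} [NormedAddCommGroup Y] [NormedSpace ℂ Y] [Module C Y] [IsScalarTower ℂ C Y]

/-- The map `x ⊗ y ↦ x(t) ⊗ y(t)`, with values in the projective tensor product of the fibres. -/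
def fiberEmb (t : characterSpace ℂ C) : X ⊗[C] Y →ₗ[ℂ] Gamma ℂ (Fiber t X) (Fiber t Y) where
  toFun w := ((show GammaPre ℂ (Fiber t X) (Fiber t Y) from fiberMap t w :
    GammaPre ℂ (Fiber t X) (Fiber t Y)) : Completion (GammaPre ℂ (Fiber t X) (Fiber t Y)))
  map_add' v w := by
    rw [map_add]
    exact Completion.coe_add _ _
  map_smul' z w := by
    rw [map_smul]
    exact (Completion.toComplₗᵢ (𝕜 := ℂ) (E := GammaPre ℂ (Fiber t X) (Fiber t Y))).map_smul z _

theorem norm_fiberEmb (t : characterSpace ℂ C) (w : X ⊗[C] Y) :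
    ‖fiberEmb t w‖ = gammaNorm (fiberMap t w) :=
  Completion.norm_coe _

theorem fiberEmb_smul (t : characterSpace ℂ C) (c : C) (w : X ⊗[C] Y) :
    fiberEmb t (c • w) = t c • fiberEmb t w := by
  rw [← map_smul]
  have h : fiberMap t (c • w) = fiberMap t (t c • w) := by rw [fiberMap_smul, map_smul]
  exact congrArg (fun v : GammaPre ℂ (Fiber t X) (Fiber t Y) =>
    (v : Completion (GammaPre ℂ (Fiber t X) (Fiber t Y)))) h

/-- The essential supremum of the projective norms of the fibres of `w`. -/
def essNorm (w : X ⊗[C] Y) : ℝ :=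
  essup fun t : characterSpace ℂ C => gammaNorm (fiberMap t w)

theorem eq_zero_of_isEmpty_characterSpace [IsEmpty (characterSpace ℂ C)] {M : Type*}
    [AddCommGroup M] [Module C M] (m : M) : m = 0 := by
  rw [← one_smul C m, show (1 : C) = 0 from eq_of_forall_character isEmptyElim, zero_smul]

variable [IsBoundedSMul C X] [IsBoundedSMul C Y]
variable [Module Cᵐᵒᵖ X] [IsCentralScalar C X] [Module Cᵐᵒᵖ Y] [IsCentralScalar C Y]

/-- Normal functionals are bounded by the essential norm. -/
theorem norm_le_essNorm_of_normal (hρ : IsVonNeumann ρ)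
    (hX : IsRepresentable C X) (hY : IsRepresentable C Y) (f : X ⊗[C] Y →+ ℂ)
    (hf : ∀ x y, ‖f (x ⊗ₜ y)‖ ≤ ‖x‖ * ‖y‖)
    (hn : ∀ x y, Continuous[weakStar ρ, inferInstance] fun c : C => f (c • x ⊗ₜ[C] y))
    (w : X ⊗[C] Y) : ‖f w‖ ≤ essNorm w := by
  have := extremallyDisconnected_characterSpace hρ
  rcases isEmpty_or_nonempty (characterSpace ℂ C) with h | h
  · rw [eq_zero_of_isEmpty_characterSpace (C := C) w, essNorm, essup_of_isEmpty]
    simp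
  have hfγ : ∀ w, ‖f w‖ ≤ gammaNorm w := fun w => by
    have := norm_le_mul_gammaNorm f zero_le_one (by simpa using hf) w
    rwa [one_mul] at this
  have hcont : Continuous[weakStar ρ, inferInstance] fun c : C => f (c • w) := by
    let _ := weakStar ρ
    induction w with
    | zero => simpa using continuous_const
    | tmul x y => exact hn x y
    | add v w hv hw =>
      simp only [smul_add, map_add]
      exact hv.add hw
  refine le_csInf ⟨gammaNorm w, ?_⟩ fun s hs => ?_
  · have : {t : characterSpace ℂ C | gammaNorm w < gammaNorm (fiberMap t w)} = ∅ :=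
      eq_empty_of_forall_notMem fun t ht => not_lt.2 (gammaNorm_fiberMap_le t w) ht
    exact (congrArg IsMeagre this).mpr IsMeagre.empty
  have hs0 : 0 ≤ s := essup_lower (fun t => gammaNorm_nonneg _) hs
  refine le_of_forall_gt_imp_ge_of_dense fun r hr => ?_
  -- The complement of a meagre set is dense by Baire, and here it is contained in the sublevel set
  -- for any r > s.
  have hd : Dense {t : characterSpace ℂ C | gammaNorm (fiberMap t w) < r} :=
    (dense_of_mem_residual hs).mono fun t ht => (not_lt.1 ht).trans_lt hr
  have hlim : Tendsto _ _ (𝓝 (f ((1 : C) • w))) := (@Continuous.tendsto C ℂ (weakStar ρ) _ _ hcont 1).comp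
    (tendsto_clopenProj_weakStar hρ (isOpen_gammaNorm_fiberMap_lt w r) hd)
  rw [one_smul] at hlim
  refine le_of_tendsto hlim.norm (Eventually.of_forall fun V => ?_)
  -- The truncated tensor has the fibres of `w` on V, where they are below `r`, and zero fibres off
  -- V.
  refine (hfγ _).trans (gammaNorm_le_of_fiberMap_le hX hY (hs0.trans hr.le) fun t => ?_)
  rw [fiberMap_smul]
  by_cases ht : t ∈ V.1
  · rw [character_clopenProj_of_mem ht, one_smul]
    exact le_of_lt (V.2 ht)
  · rw [character_clopenProj_of_notMem ht, zero_smul, gammaNorm_zero]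
    exact hs0.trans hr.le

/-- A compact extremally disconnected space has a continuous choice of ultrafilters converging
to its points. -/
theorem exists_continuous_ultrafilter (Δ : Type u) [TopologicalSpace Δ] [CompactSpace Δ]
    [T2Space Δ] [ExtremallyDisconnected Δ] :
    ∃ h : Δ → Ultrafilter Δ, Continuous h ∧ ∀ t, (h t : Filter Δ) ≤ 𝓝 t := by
  -- By Gleason's theorem the identity of Δ lifts through the canonical surjection from the space of
  -- ultrafilters onto Δ.
  obtain ⟨h, hc, he⟩ := CompactT2.ExtremallyDisconnected.projective (A := Δ) continuous_id
    (continuous_ultrafilter_extend (id : Δ → Δ))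
    (fun t => ⟨pure t, ultrafilter_extend_pure id t⟩)
  refine ⟨h, hc, fun t => ?_⟩
  have := ultrafilter_extend_eq_iff.1 (congrFun he t)
  simpa using this

/-- The limit of the bounded function `k` along `h t` exists by compactness of a disc. It depends
continuously on `t`, being the extension of `k` to ultrafilters composed with `h`; no continuity of
`k` is needed. -/
theorem exists_tendsto_character {h : characterSpace ℂ C → Ultrafilter (characterSpace ℂ C)}
    (hc : Continuous h) {k : characterSpace ℂ C → ℂ} {M : ℝ} (hk : ∀ t, ‖k t‖ ≤ M) :
    ∃ c : C, ∀ t : characterSpace ℂ C, Tendsto k (h t) (𝓝 (t c)) := by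
  let k' : characterSpace ℂ C → Metric.closedBall (0 : ℂ) M :=
    fun t => ⟨k t, mem_closedBall_zero_iff.2 (hk t)⟩
  have : CompactSpace (Metric.closedBall (0 : ℂ) M) :=
    isCompact_iff_compactSpace.1 (isCompact_closedBall _ _)
  obtain ⟨c, hc⟩ := exists_eq_character (C := C) ⟨fun t => (Ultrafilter.extend k' (h t)).1,
    continuous_subtype_val.comp ((continuous_ultrafilter_extend k').comp hc)⟩
  refine ⟨c, fun t => ?_⟩
  rw [hc]
  exact (continuous_subtype_val.tendsto _).comp
    (ultrafilter_extend_eq_iff.1 (rfl : Ultrafilter.extend k' (h t) = _))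

/-- A bounded family of functionals over the points of the spectrum can be glued to a module map
with values in `C`. -/
theorem exists_linearMap_tendsto {h : characterSpace ℂ C → Ultrafilter (characterSpace ℂ C)}
    (hc : Continuous h) (hh : ∀ t, (h t : Filter _) ≤ 𝓝 t) {M : Type*} [AddCommGroup M]
    [Module C M] (f : characterSpace ℂ C → M →+ ℂ) (hf : ∀ t c m, f t (c • m) = t c * f t m)
    {N : M → ℝ} (hN : ∀ t m, ‖f t m‖ ≤ N m) :
    ∃ Θ : M →ₗ[C] C, ∀ (t : characterSpace ℂ C) m, Tendsto (fun s => f s m) (h t) (𝓝 (t (Θ m))) := by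
  choose Θ hΘ using fun m => exists_tendsto_character hc (fun t => hN t m)
  refine ⟨⟨⟨Θ, fun m n => ?_⟩, fun c m => ?_⟩, fun t m => hΘ m t⟩
  · refine eq_of_forall_character fun t => tendsto_nhds_unique (hΘ _ t) ?_
    simpa only [map_add] using (hΘ m t).add (hΘ n t)
  · refine eq_of_forall_character fun t => tendsto_nhds_unique (hΘ _ t) ?_
    simp only [hf, RingHom.id_apply, smul_eq_mul, map_mul]
    -- Since `h t` converges to `t`, the scalars s(c) tend to t(c); this gives `C`-linearity of the
    -- limit.
    exact (((continuous_character c).tendsto t).mono_left (hh t)).mul (hΘ m t)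

/-- The essential norm is attained on `C`-bilinear contractions into `C`. -/
theorem essNorm_le_of_forall [ExtremallyDisconnected (characterSpace ℂ C)] (w : X ⊗[C] Y) {b : ℝ}
    (hb : ∀ θ : X →ₗ[C] Y →ₗ[C] C, (∀ x y, ‖θ x y‖ ≤ ‖x‖ * ‖y‖) →
      ‖TensorProduct.lift θ w‖ ≤ b) : essNorm w ≤ b := by
  have hb0 : 0 ≤ b := (norm_nonneg _).trans (hb 0 fun x y => by simp; positivity)
  rcases isEmpty_or_nonempty (characterSpace ℂ C) with h | h
  · rwa [essNorm, essup_of_isEmpty]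
  refine csInf_le ⟨0, fun c hc => essup_lower (fun t => gammaNorm_nonneg _) hc⟩ ?_
  by_contra hm
  -- Countably many closed superlevel sets exhaust {γ(w(t)) > b}. If this set is not meagre, one of
  -- them is not, and being closed it has interior.
  have hsub : {t : characterSpace ℂ C | b < gammaNorm (fiberMap t w)} ⊆
      ⋃ n : ℕ, {t : characterSpace ℂ C | b + 1 / ((n : ℝ) + 1) ≤ gammaNorm (fiberMap t w)} := by
    intro t ht
    obtain ⟨n, hn⟩ := exists_nat_one_div_lt (K := ℝ) (sub_pos.2 (show b < gammaNorm (fiberMap t w) from ht))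
    refine mem_iUnion.2 ⟨n, ?_⟩
    change b + 1 / ((n : ℝ) + 1) ≤ gammaNorm (fiberMap t w)
    linarith
  have : ∃ n : ℕ, ¬ IsMeagre
      {t : characterSpace ℂ C | b + 1 / ((n : ℝ) + 1) ≤ gammaNorm (fiberMap t w)} := by
    by_contra! hn
    exact hm ((isMeagre_iUnion hn).mono hsub)
  obtain ⟨n, hn⟩ := this
  set r := b + 1 / ((n : ℝ) + 1) with hr
  have hbr : b < r := by
    rw [hr]
    exact lt_add_of_pos_right _ (by positivity)
  have hclosed : IsClosed {t : characterSpace ℂ C | r ≤ gammaNorm (fiberMap t w)} := by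
    have := (isOpen_gammaNorm_fiberMap_lt w r).isClosed_compl
    convert! this using 1
    ext t
    simp
  have hint : (interior {t : characterSpace ℂ C | r ≤ gammaNorm (fiberMap t w)}).Nonempty := by
    by_contra hne
    exact hn (IsNowhereDense.isMeagre (hclosed.isNowhereDense_iff.2
      (not_nonempty_iff_eq_empty.1 hne)))
  obtain ⟨t₀, ht₀⟩ := hint
  -- The norming functionals are chosen independently in each fibre, with no regularity in `t`.
  choose F hF1 hFw using fun t => exists_dual_vector'' ℂ (fiberEmb t w)
  have hFq : ∀ t v, ‖F t (fiberEmb t v)‖ ≤ gammaNorm (fiberMap t v) := fun t v => by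
    rw [← norm_fiberEmb]
    simpa using (F t).le_of_opNorm_le (hF1 t) (fiberEmb t v)
  obtain ⟨h, hc, hh⟩ := exists_continuous_ultrafilter (characterSpace ℂ C)
  obtain ⟨Θ, hΘ⟩ := exists_linearMap_tendsto hc hh
    (fun t => ((F t).toLinearMap ∘ₗ fiberEmb t).toAddMonoidHom)
    (fun t c m => by
      change F t (fiberEmb t (c • m)) = t c * F t (fiberEmb t m)
      rw [fiberEmb_smul, map_smul, smul_eq_mul])
    (N := gammaNorm) (fun t m => (hFq t m).trans (gammaNorm_fiberMap_le t m))
  have hΘ' : ∀ (t : characterSpace ℂ C) m,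
      Tendsto (fun s => F s (fiberEmb s m)) (h t) (𝓝 (t (Θ m))) := hΘ
  have hle := hb ((TensorProduct.mk C X Y).compr₂ Θ) fun x y => by
    refine norm_le_of_forall_character (by positivity) fun t => ?_
    refine le_of_tendsto (hΘ' t (x ⊗ₜ y)).norm (Eventually.of_forall fun s => ?_)
    exact (hFq _ _).trans ((gammaNorm_fiberMap_le _ _).trans (gammaNorm_tmul_le _ _))
  rw [TensorProduct.lift_mk_compr₂] at hle
  refine absurd ((norm_character_le t₀ _).trans hle) (not_le.2 (hbr.trans_le ?_))
  refine ge_of_tendsto (hΘ' t₀ w).norm ?_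
  -- The ultrafilter `h t₀` converges to the interior point `t₀`, so it contains the superlevel set,
  -- on which the functionals take values at least `r` at `w`.
  filter_upwards [hh t₀ (mem_interior_iff_mem_nhds.1 ht₀)] with s hs
  rw [hFw]
  simpa [norm_fiberEmb, abs_of_nonneg (gammaNorm_nonneg _)] using hs

end EssNorm

end CentralModule

end

noncomputable section

namespace CentralModule

open Filter Set TopologicalSpace

/-! ### The norm `ν_C` is the essential norm -/

/-! ### Ultraweakly continuous functionals and norms of operators. -/

section Ultraweak

variable {H : Type u} [NormedAddCommGroup H] [InnerProductSpace ℂ H]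

theorem continuous_tsum_inner_nat {x y : ℕ → H} (hx : Summable fun n => ‖x n‖ ^ 2)
    (hy : Summable fun n => ‖y n‖ ^ 2) :
    Continuous[ultraweak H, inferInstance] fun T : H →L[ℂ] H => ∑' n, ⟪y n, T (x n)⟫_ℂ := by
  have mem : ∀ {x : ℕ → H}, (Summable fun n => ‖x n‖ ^ 2) → Memℓp x 2 := fun {x} hx => by
    refine memℓp_gen ?_
    simpa using hx
  exact continuous_iInf_dom (i := ((⟨x, mem hx⟩, ⟨y, mem hy⟩) :
    lp (fun _ : ℕ => H) 2 × lp (fun _ : ℕ => H) 2)) continuous_induced_dom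

/-- A square-summable family has countable support, so the sum can be reindexed by ℕ and padded with
zeros. Arbitrary index sets occur in amplifications over uncountable families. -/
theorem continuous_tsum_inner {ι : Type*} {x y : ι → H} (hx : Summable fun n => ‖x n‖ ^ 2)
    (hy : Summable fun n => ‖y n‖ ^ 2) :
    Continuous[ultraweak H, inferInstance] fun T : H →L[ℂ] H => ∑' n, ⟪y n, T (x n)⟫_ℂ := by
  set S := Function.support fun n => ‖x n‖ ^ 2
  have hS : Countable S := hx.countable_support
  obtain ⟨e, he⟩ := exists_injective_nat S
  have ext_sq : ∀ z : S → H, (fun n => ‖Function.extend e z 0 n‖ ^ 2) =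
      Function.extend e (fun k => ‖z k‖ ^ 2) 0 := fun z => by
    ext n
    by_cases hn : ∃ k, e k = n
    · obtain ⟨k, rfl⟩ := hn
      rw [he.extend_apply, he.extend_apply]
    · rw [Function.extend_apply' _ _ _ hn, Function.extend_apply' _ _ _ hn]
      simp
  have hsum : ∀ z : ι → H, (Summable fun n => ‖z n‖ ^ 2) →
      Summable fun n => ‖Function.extend e (fun k : S => z k) 0 n‖ ^ 2 := fun z hz => by
    rw [ext_sq]
    obtain ⟨a, ha⟩ := hz.subtype S
    exact ⟨a, (hasSum_extend_zero he).2 ha⟩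
  convert! continuous_tsum_inner_nat (hsum x hx) (hsum y hy) using 2 with T
  have h1 : (fun n => ⟪Function.extend e (fun k : S => y k) 0 n,
      T (Function.extend e (fun k : S => x k) 0 n)⟫_ℂ) =
      Function.extend e (fun k : S => ⟪y k, T (x k)⟫_ℂ) 0 := by
    ext n
    by_cases hn : ∃ k, e k = n
    · obtain ⟨k, rfl⟩ := hn
      rw [he.extend_apply, he.extend_apply, he.extend_apply]
    · rw [Function.extend_apply' _ _ _ hn, Function.extend_apply' _ _ _ hn,
        Function.extend_apply' _ _ _ hn]
      simp
  rw [h1, tsum_extend_zero he, tsum_subtype_eq_of_support_subset (f := fun k => ⟪y k, T (x k)⟫_ℂ)]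
  intro n hn
  contrapose! hn
  have : x n = 0 := by simpa [S] using hn
  simp [this]

theorem continuous_inner_ultraweak (ξ η : H) :
    Continuous[ultraweak H, inferInstance] fun T : H →L[ℂ] H => ⟪η, T ξ⟫_ℂ := by
  have := continuous_tsum_inner (ι := Unit) (x := fun _ => ξ) (y := fun _ => η)
    (hasSum_fintype _).summable (hasSum_fintype _).summable
  simpa using this

theorem norm_le_of_forall_inner {K L : Type*} [NormedAddCommGroup K] [InnerProductSpace ℂ K]
    [NormedAddCommGroup L] [InnerProductSpace ℂ L] (T : L →L[ℂ] K) {b : ℝ}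
    (h : ∀ ξ η, ‖ξ‖ ≤ 1 → ‖η‖ ≤ 1 → ‖⟪η, T ξ⟫_ℂ‖ ≤ b) : ‖T‖ ≤ b := by
  have hb : 0 ≤ b := (norm_nonneg _).trans (h 0 0 (by simp) (by simp))
  have h1 : ∀ ξ : L, ‖ξ‖ ≤ 1 → ‖T ξ‖ ≤ b := fun ξ hξ => by
    rcases eq_or_ne (T ξ) 0 with h0 | h0
    · rwa [h0, norm_zero]
    have h2 := h ξ (((‖T ξ‖⁻¹ : ℝ) : ℂ) • T ξ) hξ (by
      rw [norm_smul, Complex.norm_real, norm_inv, norm_norm]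
      exact inv_mul_le_one)
    rw [inner_smul_left, inner_self_eq_norm_sq_to_K, norm_mul, RCLike.norm_conj, Complex.norm_real,
      norm_inv, norm_norm, norm_pow] at h2
    have h3 : ‖T ξ‖ ≠ 0 := norm_ne_zero_iff.2 h0
    have h4 : ‖T ξ‖⁻¹ * ‖T ξ‖ ^ 2 = ‖T ξ‖ := by field_simp
    simpa [h4] using h2
  refine T.opNorm_le_bound hb fun ξ => ?_
  rcases eq_or_ne ξ 0 with rfl | h0
  · simp
  have h2 := h1 (((‖ξ‖⁻¹ : ℝ) : ℂ) • ξ) (by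
      rw [norm_smul, Complex.norm_real, norm_inv, norm_norm]
      exact inv_mul_le_one)
  rw [map_smul, norm_smul, Complex.norm_real, norm_inv, norm_norm,
    inv_mul_le_iff₀ (norm_pos_iff.2 h0), mul_comm] at h2
  exact h2

end Ultraweak

/-! ### Comparison of ν_C with the essential norm; formulas (ii) and (iii). -/

section NuEss

variable {C : Type u} [CommCStarAlgebra C]
variable {H : Type u} [NormedAddCommGroup H] [InnerProductSpace ℂ H] [CompleteSpace H]
variable {ρ : C →⋆ₐ[ℂ] (H →L[ℂ] H)}
variable {X : Type u} [NormedAddCommGroup X] [NormedSpace ℂ X] [Module C X] [IsScalarTower ℂ C X]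
  [IsBoundedSMul C X] [Module Cᵐᵒᵖ X] [IsCentralScalar C X]
variable {Y : Type u} [NormedAddCommGroup Y] [NormedSpace ℂ Y] [Module C Y] [IsScalarTower ℂ C Y]
  [IsBoundedSMul C Y] [Module Cᵐᵒᵖ Y] [IsCentralScalar C Y]

theorem norm_rep_of_injective (hρ : Function.Injective ρ) (c : C) : ‖ρ c‖ = ‖c‖ :=
  NonUnitalStarAlgHom.norm_map ρ hρ c

theorem isNormalRepresentable_self (hρ : Function.Injective ρ) : IsNormalRepresentable ρ C := by
  let J : C →ₗᵢ[ℂ] (H →L[ℂ] H) :=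
    ⟨ρ.toAlgHom.toLinearMap, fun c => norm_rep_of_injective hρ c⟩
  refine ⟨H, inferInstance, inferInstance, inferInstance, H, inferInstance, inferInstance,
    inferInstance, ρ, ρ, J, continuous_induced_dom, continuous_induced_dom, fun c v => ?_, fun c v => ?_⟩
  · exact map_mul ρ c v
  · exact map_mul ρ v c

theorem norm_lift_mem_nuSet (hρ : Function.Injective ρ) (w : X ⊗[C] Y) {θ : X →ₗ[C] Y →ₗ[C] C}
    (hθ : ∀ x y, ‖θ x y‖ ≤ ‖x‖ * ‖y‖) : ‖TensorProduct.lift θ w‖ ∈ nuSet ρ w := by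
  refine ⟨C, inferInstance, inferInstance, inferInstance, inferInstance, inferInstance, θ,
    isNormalRepresentable_self hρ, fun c x y => ?_, hθ, rfl⟩
  rw [op_smul_eq_smul, op_smul_eq_smul, map_smul]

/-- Values of `C`-bilinear contractions are controlled by normal balanced functionals. -/
theorem norm_lift_le_of_forall_normal {V : Type u} [NormedAddCommGroup V] [NormedSpace ℂ V]
    [Module C V] [Module Cᵐᵒᵖ V] (hV : IsNormalRepresentable ρ V) (φ : X →ₗ[C] Y →ₗ[C] V)
    (hφ : ∀ x y, ‖φ x y‖ ≤ ‖x‖ * ‖y‖) {n : ℕ} (x : Fin n → X) (y : Fin n → Y) {b : ℝ}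
    (hb : ∀ θ : X →ₗ[ℂ] Y →ₗ[ℂ] ℂ, (∀ a b, ‖θ a b‖ ≤ ‖a‖ * ‖b‖) →
      (∀ (c : C) a b, θ (op c • a) b = θ a (c • b)) →
      (∀ a b, Continuous[weakStar ρ, inferInstance] fun c : C => θ a (c • b)) →
      ‖∑ j, θ (x j) (y j)‖ ≤ b) :
    ‖TensorProduct.lift φ (∑ j, x j ⊗ₜ[C] y j)‖ ≤ b := by
  -- Compatibility of the complex scalars with the action of `C` on V is read off from the
  -- embedding.
  have := hV.isRepresentable.isScalarTower
  obtain ⟨K, _, _, _, L, _, _, _, π, σ, J, hπ, -, hl, -⟩ := hV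
  rw [← J.norm_map]
  refine norm_le_of_forall_inner _ fun ξ η hξ hη => ?_
  -- Matrix coefficients of φ at unit vectors are contractive and balanced, and normality of π makes
  -- them weak* continuous in `c`. They recover the operator norm.
  let θ : X →ₗ[ℂ] Y →ₗ[ℂ] ℂ := LinearMap.mk₂ ℂ (fun a b => ⟪η, J (φ a b) ξ⟫_ℂ)
    (fun a a' b => by simp)
    (fun z a b => by
      rw [← algebraMap_smul C z a, map_smul, LinearMap.smul_apply, algebraMap_smul, map_smul,
        smul_apply, inner_smul_right, smul_eq_mul])
    (fun a b b' => by simp)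
    (fun z a b => by
      rw [← algebraMap_smul C z b, map_smul, algebraMap_smul, map_smul,
        smul_apply, inner_smul_right, smul_eq_mul])
  have hθ : ∀ a b, θ a b = ⟪η, J (φ a b) ξ⟫_ℂ := fun a b => rfl
  have h := hb θ (fun a b => ?_) (fun c a b => ?_) (fun a b => ?_)
  · simpa [hθ, map_sum, inner_sum, sum_apply] using h
  · rw [hθ]
    refine (norm_inner_le_norm _ _).trans ?_
    have h1 := (J (φ a b)).le_of_opNorm_le ((J.norm_map _).trans_le (hφ a b)) ξ
    calc _ ≤ 1 * (‖a‖ * ‖b‖ * ‖ξ‖) := mul_le_mul hη h1 (norm_nonneg _) zero_le_one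
      _ ≤ _ := by
        rw [one_mul]
        exact mul_le_of_le_one_right (by positivity) hξ
  · rw [hθ, hθ, op_smul_eq_smul, map_smul, map_smul, LinearMap.smul_apply]
  · have : (fun c : C => θ a (c • b)) =
        (fun T : K →L[ℂ] K => ⟪η, T (J (φ a b) ξ)⟫_ℂ) ∘ π := by
      ext c
      rw [hθ, map_smul, hl]
      rfl
    rw [this]
    exact @Continuous.comp _ _ _ (weakStar ρ) (ultraweak K) _ _ _
      (continuous_inner_ultraweak _ _) hπ

/-- Normal balanced functionals are controlled by the essential norm. -/
theorem norm_sum_le_essNorm_of_normal (hρ : IsVonNeumann ρ) (hX : IsRepresentable C X)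
    (hY : IsRepresentable C Y) (θ : X →ₗ[ℂ] Y →ₗ[ℂ] ℂ) (h1 : ∀ a b, ‖θ a b‖ ≤ ‖a‖ * ‖b‖)
    (h2 : ∀ (c : C) a b, θ (op c • a) b = θ a (c • b))
    (h3 : ∀ a b, Continuous[weakStar ρ, inferInstance] fun c : C => θ a (c • b))
    {n : ℕ} (x : Fin n → X) (y : Fin n → Y) :
    ‖∑ j, θ (x j) (y j)‖ ≤ essNorm (∑ j, x j ⊗ₜ[C] y j) := by
  have hbal : ∀ (c : C) a b, θ (c • a) b = θ a (c • b) := fun c a b => by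
    rw [← op_smul_eq_smul, h2]
  let f : X ⊗[C] Y →+ ℂ := TensorProduct.liftAddHom
    (LinearMap.toAddMonoidHom'.comp θ.toAddMonoidHom) hbal
  have hf : ∀ a b, f (a ⊗ₜ b) = θ a b := fun a b => rfl
  have := norm_le_essNorm_of_normal hρ hX hY f (fun a b => by rw [hf]; exact h1 a b)
    (fun a b => by simpa only [TensorProduct.smul_tmul', hf, hbal] using h3 a b)
    (∑ j, x j ⊗ₜ[C] y j)
  simpa [map_sum, hf] using this

theorem le_essNorm_of_mem_nuSet (hρ : IsVonNeumann ρ) (hX : IsRepresentable C X)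
    (hY : IsRepresentable C Y) {w : X ⊗[C] Y} {r : ℝ} (hr : r ∈ nuSet ρ w) : r ≤ essNorm w := by
  obtain ⟨V, _, _, _, _, _, φ, hV, -, hφ, rfl⟩ := hr
  obtain ⟨n, x, y, rfl⟩ := exists_rep w
  exact norm_lift_le_of_forall_normal hV φ hφ x y fun θ h1 h2 h3 =>
    norm_sum_le_essNorm_of_normal hρ hX hY θ h1 h2 h3 x y

/-- The upper bound comes from matrix coefficients. The lower bound holds because the contractions
into `C` built in `essNorm_le_of_forall` are among the maps defining ν_C. -/
theorem nuNorm_eq_essNorm (hρ : IsVonNeumann ρ) (hX : IsRepresentable C X)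
    (hY : IsRepresentable C Y) (w : X ⊗[C] Y) : nuNorm ρ w = essNorm w := by
  have := extremallyDisconnected_characterSpace hρ
  refine le_antisymm (csSup_le ⟨_, norm_lift_mem_nuSet hρ.1 w (θ := 0) fun x y => ?_⟩
    fun r hr => le_essNorm_of_mem_nuSet hρ hX hY hr) ?_
  · simp only [LinearMap.zero_apply, norm_zero]
    positivity
  · exact essNorm_le_of_forall w fun θ hθ =>
      le_csSup (nuSet_bddAbove ρ w) (norm_lift_mem_nuSet hρ.1 w hθ)

theorem nuNorm_le_of_forall_lift (hρ : IsVonNeumann ρ) (hX : IsRepresentable C X)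
    (hY : IsRepresentable C Y) (w : X ⊗[C] Y) {b : ℝ}
    (hb : ∀ θ : X →ₗ[C] Y →ₗ[C] C, (∀ x y, ‖θ x y‖ ≤ ‖x‖ * ‖y‖) →
      ‖TensorProduct.lift θ w‖ ≤ b) : nuNorm ρ w ≤ b := by
  have := extremallyDisconnected_characterSpace hρ
  rw [nuNorm_eq_essNorm hρ hX hY]
  exact essNorm_le_of_forall w hb

theorem isLUB_nuNorm_module (hρ : IsVonNeumann ρ) (hX : IsRepresentable C X)
    (hY : IsRepresentable C Y) {n : ℕ} (x : Fin n → X) (y : Fin n → Y) :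
    IsLUB {r : ℝ | ∃ θ : X →ₗ[C] Y →ₗ[C] C, (∀ a b, ‖θ a b‖ ≤ ‖a‖ * ‖b‖) ∧
        r = ‖∑ j, θ (x j) (y j)‖} (nuNorm ρ (∑ j, x j ⊗ₜ[C] y j)) := by
  have e : ∀ θ : X →ₗ[C] Y →ₗ[C] C,
      TensorProduct.lift θ (∑ j, x j ⊗ₜ[C] y j) = ∑ j, θ (x j) (y j) := fun θ => by
    simp [map_sum]
  constructor
  · rintro r ⟨θ, hθ, rfl⟩
    rw [← e]
    exact le_csSup (nuSet_bddAbove ρ _) (norm_lift_mem_nuSet hρ.1 _ hθ)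
  · intro b hb
    exact nuNorm_le_of_forall_lift hρ hX hY _ fun θ hθ => hb ⟨θ, hθ, by rw [e]⟩

/-- Normal balanced functionals stay below the essential norm, which is ν_C; conversely, matrix
coefficients bring each map that defines ν_C below any upper bound of these functionals. -/
theorem isLUB_nuNorm_normal (hρ : IsVonNeumann ρ) (hX : IsRepresentable C X)
    (hY : IsRepresentable C Y) {n : ℕ} (x : Fin n → X) (y : Fin n → Y) :
    IsLUB {r : ℝ | ∃ θ : X →ₗ[ℂ] Y →ₗ[ℂ] ℂ, (∀ a b, ‖θ a b‖ ≤ ‖a‖ * ‖b‖) ∧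
          (∀ (c : C) a b, θ (op c • a) b = θ a (c • b)) ∧
          (∀ a b, Continuous[weakStar ρ, inferInstance] fun c : C => θ a (c • b)) ∧
          r = ‖∑ j, θ (x j) (y j)‖}
        (nuNorm ρ (∑ j, x j ⊗ₜ[C] y j)) := by
  constructor
  · rintro r ⟨θ, h1, h2, h3, rfl⟩
    rw [nuNorm_eq_essNorm hρ hX hY]
    exact norm_sum_le_essNorm_of_normal hρ hX hY θ h1 h2 h3 x y
  · intro b hb
    refine csSup_le ⟨_, norm_lift_mem_nuSet hρ.1 _ (θ := 0) fun x y => ?_⟩ ?_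
    · simp only [LinearMap.zero_apply, norm_zero]
      positivity
    · rintro r ⟨V, _, _, _, _, _, φ, hV, -, hφ, rfl⟩
      exact norm_lift_le_of_forall_normal hV φ hφ x y fun θ h1 h2 h3 => hb ⟨θ, h1, h2, h3, rfl⟩

end NuEss

end CentralModule

end

noncomputable section

namespace CentralModule

open Filter Set TopologicalSpace

/-! ### Diagonal representations -/

section Diagonal

variable {C : Type u} [CommCStarAlgebra C]
variable {I : Type u} {E : Type*} [NormedAddCommGroup E] [InnerProductSpace ℂ E] [CompleteSpace E]

/-- The direct sum of a family of representations on the same Hilbert space. -/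
def diagRep (π : I → C →⋆ₐ[ℂ] (E →L[ℂ] E)) :
    C →⋆ₐ[ℂ] (lp (fun _ : I => E) 2 →L[ℂ] lp (fun _ : I => E) 2) where
  toFun c := lp.mapCLM 2 (fun i => π i c) (norm_nonneg c)
    fun i => NonUnitalStarAlgHom.norm_apply_le (π i) c
  map_one' := by ext x i; simp
  map_mul' a b := by ext x i; simp
  map_zero' := by ext x i; simp
  map_add' a b := by ext x i; simp
  commutes' z := by
    ext x i
    simp [Algebra.algebraMap_eq_smul_one]
  map_star' c := by
    rw [ContinuousLinearMap.star_eq_adjoint, ContinuousLinearMap.eq_adjoint_iff]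
    intro x y
    rw [lp.inner_eq_tsum, lp.inner_eq_tsum]
    refine tsum_congr fun i => ?_
    change ⟪π i (star c) (x i), y i⟫_ℂ = ⟪x i, π i c (y i)⟫_ℂ
    rw [map_star, ContinuousLinearMap.star_eq_adjoint, ContinuousLinearMap.adjoint_inner_left]

/-- The diagonal embedding defined by a norming family of contractive operator valued maps. -/
def diagEmb {V : Type*} [SeminormedAddCommGroup V] [NormedSpace ℂ V]
    (f : I → V →ₗ[ℂ] (E →L[ℂ] E)) (hf : ∀ i v, ‖f i v‖ ≤ ‖v‖)
    (hn : ∀ v b, 0 ≤ b → (∀ i, ‖f i v‖ ≤ b) → ‖v‖ ≤ b) :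
    V →ₗᵢ[ℂ] (lp (fun _ : I => E) 2 →L[ℂ] lp (fun _ : I => E) 2) where
  toFun v := lp.mapCLM 2 (fun i => f i v) (norm_nonneg v) fun i => hf i v
  map_add' v w := by ext x i; simp
  map_smul' z v := by ext x i; simp
  norm_map' v := by
    classical
    set T : lp (fun _ : I => E) 2 →L[ℂ] lp (fun _ : I => E) 2 :=
      lp.mapCLM 2 (fun i => f i v) (norm_nonneg v) fun i => hf i v with hT
    change ‖T‖ = ‖v‖
    refine le_antisymm (lp.norm_mapCLM_le 2 (fun i => f i v) (norm_nonneg v) fun i => hf i v)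
      (hn v _ (norm_nonneg _) fun i => ?_)
    refine ContinuousLinearMap.opNorm_le_bound _ (norm_nonneg _) fun ξ => ?_
    -- The i-th block is recovered by feeding in vectors supported at i and reading off coordinate
    -- i.
    have h1 : f i v ξ = T (lp.single 2 i ξ) i := by
      change f i v ξ = f i v ((lp.single 2 i ξ : lp (fun _ : I => E) 2) i)
      rw [lp.single_apply_self]
    rw [h1]
    refine (lp.norm_apply_le_norm (by norm_num) _ i).trans ?_
    refine (T.le_opNorm _).trans_eq ?_
    rw [lp.norm_single (by norm_num)]

theorem summable_norm_sq (x : lp (fun _ : I => E) 2) : Summable fun i => ‖x i‖ ^ 2 := by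
  have := (lp.memℓp x).summable (by norm_num)
  simpa using this

theorem tsum_norm_sq (x : lp (fun _ : I => E) 2) : ∑' i, ‖x i‖ ^ 2 = ‖x‖ ^ 2 := by
  have := lp.norm_rpow_eq_tsum (p := 2) (by norm_num) x
  simpa using this.symm

/-- Amplifications of the identity representation are normal. -/
theorem isNormalRep_diagRep {H : Type u} [NormedAddCommGroup H] [InnerProductSpace ℂ H]
    [CompleteSpace H] (ρ : C →⋆ₐ[ℂ] (H →L[ℂ] H)) :
    IsNormalRep ρ (diagRep fun _ : I => ρ) := by
  have hsum : ∀ x : lp (fun _ : ℕ => lp (fun _ : I => H) 2) 2,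
      Summable fun k : ℕ × I => ‖x k.1 k.2‖ ^ 2 := fun x => by
    rw [summable_prod_of_nonneg fun k => by positivity]
    refine ⟨fun n => summable_norm_sq (x n), ?_⟩
    simp only [tsum_norm_sq]
    have := (lp.memℓp x).summable (by norm_num)
    simpa using this
  refine continuous_iInf_rng.2 fun p => continuous_induced_rng.2 ?_
  -- An ultraweak functional pulled back along the amplification becomes one on `H` with vectors
  -- indexed by ℕ × I.
  have key : ((fun T : lp (fun _ : I => H) 2 →L[ℂ] lp (fun _ : I => H) 2 =>
      ∑' n, ⟪p.2 n, T (p.1 n)⟫_ℂ) ∘ diagRep fun _ : I => ρ) =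
      (fun T : H →L[ℂ] H => ∑' k : ℕ × I, ⟪p.2 k.1 k.2, T (p.1 k.1 k.2)⟫_ℂ) ∘ ρ := by
    ext c
    have hs : Summable fun k : ℕ × I => ⟪p.2 k.1 k.2, ρ c (p.1 k.1 k.2)⟫_ℂ := by
      refine Summable.of_norm_bounded (((hsum p.2).add (hsum p.1)).mul_left ‖ρ c‖) fun k => ?_
      have h1 := norm_inner_le_norm (𝕜 := ℂ) (p.2 k.1 k.2) (ρ c (p.1 k.1 k.2))
      have h2 := mul_le_mul_of_nonneg_left ((ρ c).le_opNorm (p.1 k.1 k.2))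
        (norm_nonneg (p.2 k.1 k.2))
      have h3 : ‖p.2 k.1 k.2‖ * ‖p.1 k.1 k.2‖ ≤ ‖p.2 k.1 k.2‖ ^ 2 + ‖p.1 k.1 k.2‖ ^ 2 := by
        nlinarith [sq_nonneg (‖p.2 k.1 k.2‖ - ‖p.1 k.1 k.2‖), sq_nonneg ‖p.2 k.1 k.2‖,
          sq_nonneg ‖p.1 k.1 k.2‖]
      have h4 := mul_le_mul_of_nonneg_left h3 (norm_nonneg (ρ c))
      linarith
    rw [Function.comp_apply, Function.comp_apply, hs.tsum_prod]
    refine tsum_congr fun n => ?_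
    rw [lp.inner_eq_tsum]
    rfl
  rw [key]
  exact @Continuous.comp _ _ _ (weakStar ρ) (ultraweak H) _ _ _
    (continuous_tsum_inner (hsum p.1) (hsum p.2)) continuous_induced_dom

end Diagonal

/-! ### Extension to completions -/

section Extension

variable {V : Type*} [SeminormedAddCommGroup V] [NormedSpace ℂ V]
variable {W : Type*} [NormedAddCommGroup W] [NormedSpace ℂ W] [CompleteSpace W]

theorem exists_extension_completion (f : V →ₗ[ℂ] W) {M : ℝ} (hM : 0 ≤ M)
    (hf : ∀ v, ‖f v‖ ≤ M * ‖v‖) :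
    ∃ F : Completion V →L[ℂ] W, (∀ v : V, F v = f v) ∧ ‖F‖ ≤ M := by
  have hd : DenseRange (Completion.toComplL : V →L[ℂ] Completion V) := Completion.denseRange_coe
  have hu : IsUniformInducing (Completion.toComplL : V →L[ℂ] Completion V) :=
    Completion.isUniformInducing_coe V
  have hF : ∀ v : V, (f.mkContinuous M hf).extend (Completion.toComplL : V →L[ℂ] Completion V) v =
      f v := fun v => ContinuousLinearMap.extend_eq (f.mkContinuous M hf) hd hu v
  refine ⟨(f.mkContinuous M hf).extend Completion.toComplL, hF, ?_⟩
  refine ContinuousLinearMap.opNorm_le_bound _ hM fun v => ?_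
  refine Completion.induction_on v (isClosed_le (by fun_prop) (by fun_prop)) fun v => ?_
  rw [hF, Completion.norm_coe]
  exact hf v

theorem exists_isometry_completion (f : V →ₗᵢ[ℂ] W) :
    ∃ F : Completion V →ₗᵢ[ℂ] W, ∀ v : V, F v = f v := by
  obtain ⟨F, hF, -⟩ := exists_extension_completion f.toLinearMap zero_le_one
    (fun v => by rw [one_mul]; exact (f.norm_map v).le)
  refine ⟨⟨F.toLinearMap, fun v => ?_⟩, hF⟩
  refine Completion.induction_on v (isClosed_eq F.continuous.norm (by fun_prop)) fun v => ?_
  rw [Completion.norm_coe, ← f.norm_map v]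
  exact congrArg norm (hF v)

variable {C : Type u} [CommCStarAlgebra C]
variable {K : Type*} [NormedAddCommGroup K] [InnerProductSpace ℂ K] [CompleteSpace K]

theorem exists_rep_completion [Module C V] [IsBoundedSMul C V]
    (π : C →⋆ₐ[ℂ] (K →L[ℂ] K)) (J₀ : V →ₗᵢ[ℂ] (K →L[ℂ] K))
    (hl : ∀ (c : C) (v : V), J₀ (c • v) = (π c).comp (J₀ v))
    (hr : ∀ (c : C) (v : V), J₀ (c • v) = (J₀ v).comp (π c)) :
    ∃ J : Completion V →ₗᵢ[ℂ] (K →L[ℂ] K),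
      (∀ (c : C) (v : Completion V), J (c • v) = (π c).comp (J v)) ∧
      (∀ (c : C) (v : Completion V), J (c • v) = (J v).comp (π c)) := by
  obtain ⟨J, hJ⟩ := exists_isometry_completion J₀
  refine ⟨J, fun c v => ?_, fun c v => ?_⟩
  · refine Completion.induction_on v (isClosed_eq (J.continuous.comp (continuous_const_smul c))
      (((ContinuousLinearMap.compL ℂ K K K) (π c)).continuous.comp J.continuous)) fun v => ?_
    rw [← Completion.coe_smul, hJ, hJ, hl]
  · refine Completion.induction_on v (isClosed_eq (J.continuous.comp (continuous_const_smul c))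
      (((ContinuousLinearMap.compL ℂ K K K).flip (π c)).continuous.comp J.continuous)) fun v => ?_
    rw [← Completion.coe_smul, hJ, hJ, hr]

end Extension

/-! ### Representability of the tensor products -/

section TensorRep

variable {C : Type u} [CommCStarAlgebra C]
variable {H : Type u} [NormedAddCommGroup H] [InnerProductSpace ℂ H] [CompleteSpace H]
variable {ρ : C →⋆ₐ[ℂ] (H →L[ℂ] H)}
variable {X : Type u} [NormedAddCommGroup X] [NormedSpace ℂ X] [Module C X] [IsScalarTower ℂ C X]
  [IsBoundedSMul C X] [Module Cᵐᵒᵖ X] [IsCentralScalar C X]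
variable {Y : Type u} [NormedAddCommGroup Y] [NormedSpace ℂ Y] [Module C Y] [IsScalarTower ℂ C Y]
  [IsBoundedSMul C Y] [Module Cᵐᵒᵖ Y] [IsCentralScalar C Y]

/-- A character as a one-dimensional representation. -/
def characterRep (t : characterSpace ℂ C) : C →⋆ₐ[ℂ] (ℂ →L[ℂ] ℂ) where
  toFun c := t c • 1
  map_one' := by ext; simp
  map_mul' a b := by ext; simp [mul_comm]
  map_zero' := by ext; simp
  map_add' a b := by ext; simp
  commutes' z := by
    ext
    simp [AlgHomClass.commutes]
  map_star' c := by rw [map_star, star_smul, star_one]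

variable (C X Y) in
/-- The identity map from the projectively seminormed space to the algebraic tensor product. -/
def GammaPre.toTensor : GammaPre C X Y →ₗ[ℂ] X ⊗[C] Y where
  toFun w := w
  map_add' _ _ := rfl
  map_smul' _ _ := rfl

theorem GammaPre.toTensor_smul (c : C) (w : GammaPre C X Y) :
    toTensor C X Y (c • w) = c • toTensor C X Y w := rfl

variable (ρ X Y) in
/-- The identity map from the space with the norm `ν_C` to the algebraic tensor product. -/
def NuPre.toTensor : NuPre ρ X Y →ₗ[ℂ] X ⊗[C] Y where
  toFun w := w
  map_add' _ _ := rfl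
  map_smul' _ _ := rfl

theorem NuPre.norm_eq (w : NuPre ρ X Y) : ‖w‖ = nuNorm ρ (toTensor ρ X Y w) := rfl

theorem NuPre.toTensor_smul (c : C) (w : NuPre ρ X Y) :
    toTensor ρ X Y (c • w) = c • toTensor ρ X Y w := rfl

theorem norm_smul_one_clm (z : ℂ) : ‖z • (1 : ℂ →L[ℂ] ℂ)‖ = ‖z‖ := by
  rw [norm_smul, norm_one, mul_one]

/-- Place the norming functionals on the diagonal of ℓ²(I), with `C` acting on coordinate i through
τ_i. Scalars commute, so one representation serves both sides. -/
theorem exists_rep_of_characters {V : Type*} [SeminormedAddCommGroup V] [NormedSpace ℂ V]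
    [Module C V] [IsBoundedSMul C V] {I : Type u} (τ : I → characterSpace ℂ C)
    (g : I → V →ₗ[ℂ] ℂ) (hle : ∀ i v, ‖g i v‖ ≤ ‖v‖)
    (hge : ∀ v b, 0 ≤ b → (∀ i, ‖g i v‖ ≤ b) → ‖v‖ ≤ b)
    (hg : ∀ i (c : C) v, g i (c • v) = τ i c * g i v) :
    ∃ J : Completion V →ₗᵢ[ℂ] (lp (fun _ : I => ℂ) 2 →L[ℂ] lp (fun _ : I => ℂ) 2),
      (∀ (c : C) (v : Completion V),
        J (c • v) = (diagRep (fun i => characterRep (τ i)) c).comp (J v)) ∧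
      (∀ (c : C) (v : Completion V),
        J (c • v) = (J v).comp (diagRep (fun i => characterRep (τ i)) c)) := by
  let f : I → V →ₗ[ℂ] (ℂ →L[ℂ] ℂ) := fun i =>
    (LinearMap.toSpanSingleton ℂ (ℂ →L[ℂ] ℂ) 1) ∘ₗ g i
  have hn : ∀ i v, ‖f i v‖ = ‖g i v‖ := fun i v => norm_smul_one_clm _
  refine exists_rep_completion _ (diagEmb f (fun i v => (hn i v).trans_le (hle i v))
    fun v b hb h => hge v b hb fun i => (hn i v).symm.trans_le (h i)) (fun c v => ?_) fun c v => ?_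
  · ext x i
    change g i (c • v) * x i = τ i c * (g i v * x i)
    rw [hg, mul_assoc]
  · ext x i
    change g i (c • v) * x i = g i v * (τ i c * x i)
    rw [hg, mul_assoc, mul_left_comm]

variable (X Y) in
/-- The functional on the tensor product defined by a functional on a fibre. -/
def fiberFunctional (t : characterSpace ℂ C)
    (F : StrongDual ℂ (Gamma ℂ (Fiber t X) (Fiber t Y))) : GammaPre C X Y →ₗ[ℂ] ℂ :=
  F.toLinearMap ∘ₗ fiberEmb t ∘ₗ GammaPre.toTensor C X Y

theorem fiberFunctional_apply (t : characterSpace ℂ C)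
    (F : StrongDual ℂ (Gamma ℂ (Fiber t X) (Fiber t Y))) (w : GammaPre C X Y) :
    fiberFunctional X Y t F w = F (fiberEmb t (GammaPre.toTensor C X Y w)) := rfl

theorem norm_fiberFunctional_le (t : characterSpace ℂ C)
    (F : StrongDual ℂ (Gamma ℂ (Fiber t X) (Fiber t Y))) (hF : ‖F‖ ≤ 1) (w : GammaPre C X Y) :
    ‖fiberFunctional X Y t F w‖ ≤ ‖w‖ := by
  have h1 := F.le_of_opNorm_le hF (fiberEmb t (GammaPre.toTensor C X Y w))
  rw [one_mul, norm_fiberEmb] at h1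
  exact h1.trans (gammaNorm_fiberMap_le t _)

theorem fiberFunctional_smul (t : characterSpace ℂ C)
    (F : StrongDual ℂ (Gamma ℂ (Fiber t X) (Fiber t Y))) (c : C) (w : GammaPre C X Y) :
    fiberFunctional X Y t F (c • w) = t c * fiberFunctional X Y t F w := by
  rw [fiberFunctional_apply, fiberFunctional_apply, GammaPre.toTensor_smul, fiberEmb_smul,
    map_smul, smul_eq_mul]

theorem norm_le_of_forall_fiberFunctional [ExtremallyDisconnected (characterSpace ℂ C)]
    (hX : IsRepresentable C X) (hY : IsRepresentable C Y) (w : GammaPre C X Y) {b : ℝ}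
    (hb : 0 ≤ b) (h : ∀ t F, ‖F‖ ≤ 1 → ‖fiberFunctional X Y t F w‖ ≤ b) : ‖w‖ ≤ b := by
  refine gammaNorm_le_of_fiberMap_le hX hY hb fun t => ?_
  obtain ⟨F, hF1, hF⟩ := exists_dual_vector'' ℂ (fiberEmb t (GammaPre.toTensor C X Y w))
  have h1 := h t F hF1
  rw [fiberFunctional_apply, hF] at h1
  simp only [Complex.coe_algebraMap, Complex.norm_real, norm_fiberEmb,
    Real.norm_of_nonneg (gammaNorm_nonneg _)] at h1
  exact h1

theorem isRepresentable_gamma [ExtremallyDisconnected (characterSpace ℂ C)]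
    (hX : IsRepresentable C X) (hY : IsRepresentable C Y) : IsRepresentable C (Gamma C X Y) := by
  -- The index set consists of all pairs of a point and a functional in the dual unit ball of its
  -- fibre; this family is norming by the fibre formula for γ_C and Hahn–Banach.
  obtain ⟨J, hl, hr⟩ := exists_rep_of_characters
    (fun i : Σ t : characterSpace ℂ C,
      {F : StrongDual ℂ (Gamma ℂ (Fiber t X) (Fiber t Y)) // ‖F‖ ≤ 1} => i.1)
    (fun i => fiberFunctional X Y i.1 i.2.1)
    (fun i w => norm_fiberFunctional_le i.1 i.2.1 i.2.2 w)
    (fun w b hb hw => norm_le_of_forall_fiberFunctional hX hY w hb fun t F hF => hw ⟨t, F, hF⟩)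
    (fun i c w => fiberFunctional_smul i.1 i.2.1 c w)
  have hop : ∀ (c : C) (v : Gamma C X Y), op c • v = c • v := fun c v => op_smul_eq_smul c v
  exact ⟨_, _, _, inferInstance, _, _, _, inferInstance, _, _, J, hl,
    fun c v => (congrArg J (hop c v)).trans (hr c v)⟩

/-- Contractive bilinear maps into `C` norm ν_C. Followed by `ρ` and put on a diagonal, they embed
the completion in operators on a multiple of `H`, where `C` acts by an amplification of `ρ`, hence
normally. -/
theorem isNormalRepresentable_nu (hρ : IsVonNeumann ρ) (hX : IsRepresentable C X)
    (hY : IsRepresentable C Y) : IsNormalRepresentable ρ (Nu ρ X Y) := by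
  let I : Type u := {θ : X →ₗ[C] Y →ₗ[C] C // ∀ x y, ‖θ x y‖ ≤ ‖x‖ * ‖y‖}
  let f : I → NuPre ρ X Y →ₗ[ℂ] (H →L[ℂ] H) := fun i =>
    ρ.toAlgHom.toLinearMap ∘ₗ (TensorProduct.lift i.1).restrictScalars ℂ ∘ₗ NuPre.toTensor ρ X Y
  have hf : ∀ i w, f i w = ρ (TensorProduct.lift i.1 (NuPre.toTensor ρ X Y w)) := fun i w => rfl
  have hle : ∀ i w, ‖f i w‖ ≤ ‖w‖ := fun i w => by
    rw [hf, norm_rep_of_injective hρ.1]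
    exact le_csSup (nuSet_bddAbove ρ _) (norm_lift_mem_nuSet hρ.1 _ i.2)
  have hge : ∀ w b, 0 ≤ b → (∀ i, ‖f i w‖ ≤ b) → ‖w‖ ≤ b := fun w b hb hw => by
    rw [NuPre.norm_eq w]
    refine nuNorm_le_of_forall_lift hρ hX hY _ fun θ hθ => ?_
    rw [← norm_rep_of_injective hρ.1]
    exact hw ⟨θ, hθ⟩
  have hsmul : ∀ i (c : C) w, f i (c • w) = ρ c * f i w := fun i c w => by
    rw [hf, hf, NuPre.toTensor_smul, map_smul, smul_eq_mul, map_mul]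
  have hsmul' : ∀ i (c : C) w, f i (c • w) = f i w * ρ c := fun i c w => by
    rw [hf, hf, NuPre.toTensor_smul, map_smul, smul_eq_mul, mul_comm, map_mul]
  obtain ⟨J, hl, hr⟩ := exists_rep_completion (diagRep fun _ : I => ρ) (diagEmb f hle hge)
    (fun c w => by
      ext x i
      change f i (c • w) (x i) = ρ c (f i w (x i))
      rw [hsmul]
      rfl)
    (fun c w => by
      ext x i
      change f i (c • w) (x i) = f i w (ρ c (x i))
      rw [hsmul']
      rfl)
  exact ⟨_, _, _, inferInstance, _, _, _, inferInstance, _, _, J, isNormalRep_diagRep ρ,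
    isNormalRep_diagRep ρ, hl, fun c v => by rw [op_smul_eq_smul]; exact hr c v⟩

end TensorRep

end CentralModule

end

noncomputable section

namespace CentralModule

open Filter Set TopologicalSpace

/-! ### Completeness of essential direct sums -/

section EssComplete

variable {Δ : Type u} [TopologicalSpace Δ] [BaireSpace Δ]
variable {E : Δ → Type u} [∀ t, NormedAddCommGroup (E t)]

theorem EssSum.norm_mk (x : lp E ∞) : ‖EssSum.mk x‖ = essup fun t => ‖x t‖ := rfl

theorem EssSum.mk_sub (x y : lp E ∞) : EssSum.mk (x - y) = EssSum.mk x - EssSum.mk y := rfl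

theorem EssSum.norm_mk_le (x : lp E ∞) : ‖EssSum.mk x‖ ≤ ‖x‖ := by
  rw [EssSum.norm_mk]
  rcases isEmpty_or_nonempty Δ with h | h
  · rw [essup_of_isEmpty]
    exact norm_nonneg x
  refine csInf_le ⟨0, fun c hc => essup_lower (fun t => norm_nonneg _) hc⟩ ?_
  have : {t | ‖x‖ < ‖x t‖} = ∅ := eq_empty_of_forall_notMem fun t ht =>
    absurd (lp.norm_apply_le_norm ENNReal.top_ne_zero x t) (not_le.2 ht)
  exact (congrArg IsMeagre this).mpr IsMeagre.empty

/-- Truncation on a meagre set: every element has a representative with almost the same norm. -/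
theorem EssSum.exists_mk_eq_norm_lt (z : EssSum E) {r : ℝ} (hr : ‖z‖ < r) :
    ∃ x : lp E ∞, EssSum.mk x = z ∧ ‖x‖ ≤ r := by
  classical
  obtain ⟨x, rfl⟩ : ∃ x : lp E ∞, EssSum.mk x = z := SeparationQuotient.surjective_mk z
  have hr0 : 0 ≤ r := (norm_nonneg _).trans hr.le
  rcases isEmpty_or_nonempty Δ with h | h
  · exact ⟨x, rfl, lp.norm_le_of_forall_le hr0 isEmptyElim⟩
  rw [EssSum.norm_mk] at hr
  have hne : {c : ℝ | IsMeagre {t | c < ‖x t‖}}.Nonempty := by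
    refine ⟨‖x‖, ?_⟩
    have : {t | ‖x‖ < ‖x t‖} = ∅ := eq_empty_of_forall_notMem fun t ht =>
      absurd (lp.norm_apply_le_norm ENNReal.top_ne_zero x t) (not_le.2 ht)
    exact (congrArg IsMeagre this).mpr IsMeagre.empty
  obtain ⟨c, hc, hcr⟩ := exists_lt_of_csInf_lt hne hr
  have hle : ∀ t, ‖(if ‖x t‖ ≤ c then x t else 0 : E t)‖ ≤ r := fun t => by
    split_ifs with ht
    · exact ht.trans hcr.le
    · rwa [norm_zero]
  let y : lp E ∞ := ⟨fun t => if ‖x t‖ ≤ c then x t else 0,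
    memℓp_infty ⟨r, by rintro _ ⟨t, rfl⟩; exact hle t⟩⟩
  refine ⟨y, ?_, lp.norm_le_of_forall_le hr0 hle⟩
  -- The truncation differs from `x` only where ‖x(t)‖ > c, a meagre set, so both have the same
  -- class.
  rw [← sub_eq_zero, ← EssSum.mk_sub, ← norm_le_zero_iff, EssSum.norm_mk]
  refine csInf_le ⟨0, fun c hc => essup_lower (fun t => norm_nonneg _) hc⟩ (IsMeagre.mono ?_ hc)
  intro t ht
  by_contra hn
  have hy : y t = x t := if_pos (not_lt.1 hn)
  have ht : 0 < ‖(y - x) t‖ := ht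
  rw [lp.coeFn_sub, Pi.sub_apply, hy, sub_self, norm_zero] at ht
  exact lt_irrefl _ ht

instance EssSum.completeSpace [∀ t, CompleteSpace (E t)] : CompleteSpace (EssSum E) := by
  refine NormedAddCommGroup.completeSpace_of_summable_imp_tendsto fun u hu => ?_
  -- Representatives with norm exceeding that of the class by at most 2⁻ⁿ turn an absolutely
  -- convergent series of classes into one in the ℓ^∞-sum.
  choose x hx hxn using fun n => EssSum.exists_mk_eq_norm_lt (u n)
    (lt_add_of_pos_right ‖u n‖ (by positivity : (0 : ℝ) < (1 / 2) ^ n))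
  have hs : Summable x := Summable.of_norm_bounded (hu.add summable_geometric_two) hxn
  let q : lp E ∞ →+ EssSum E := AddMonoidHom.mk' EssSum.mk fun x y => rfl
  have hq : Continuous q := AddMonoidHomClass.continuous_of_bound q 1 fun x => by
    rw [one_mul]
    exact EssSum.norm_mk_le x
  refine ⟨q (∑' n, x n), ?_⟩
  have := (hq.tendsto _).comp hs.hasSum.tendsto_sum_nat
  refine this.congr fun n => ?_
  rw [Function.comp_apply, map_sum]
  exact Finset.sum_congr rfl fun i _ => hx i

end EssComplete

end CentralModule

end

noncomputable section

namespace CentralModule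

open Filter Set TopologicalSpace

/-! ### The normal part of the projective tensor product -/

section NormalPart

variable {C : Type u} [CommCStarAlgebra C]
variable {H : Type u} [NormedAddCommGroup H] [InnerProductSpace ℂ H] [CompleteSpace H]
variable {ρ : C →⋆ₐ[ℂ] (H →L[ℂ] H)}
variable {X : Type u} [NormedAddCommGroup X] [NormedSpace ℂ X] [Module C X] [IsScalarTower ℂ C X]
  [IsBoundedSMul C X] [Module Cᵐᵒᵖ X] [IsCentralScalar C X]
variable {Y : Type u} [NormedAddCommGroup Y] [NormedSpace ℂ Y] [Module C Y] [IsScalarTower ℂ C Y]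
  [IsBoundedSMul C Y] [Module Cᵐᵒᵖ Y] [IsCentralScalar C Y]

/-- Needed for density arguments: the target of the universal property carries only algebraic
actions, and their continuity comes from the representation. -/
theorem IsRepresentable.continuous_smul {V : Type u} [NormedAddCommGroup V] [NormedSpace ℂ V]
    [Module C V] [Module Cᵐᵒᵖ V] (h : IsRepresentable C V) (c : C) :
    Continuous (fun v : V => c • v) ∧ Continuous fun v : V => op c • v := by
  obtain ⟨K, _, _, _, L, _, _, _, π, σ, J, hl, hr⟩ := h
  constructor
  · rw [J.isometry.isUniformInducing.isInducing.continuous_iff]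
    have : (J ∘ fun v : V => c • v) = fun v => (π c).comp (J v) := funext fun v => hl c v
    rw [this]
    exact ((ContinuousLinearMap.compL ℂ L K K) (π c)).continuous.comp J.continuous
  · rw [J.isometry.isUniformInducing.isInducing.continuous_iff]
    have : (J ∘ fun v : V => op c • v) = fun v => (J v).comp (σ c) := funext fun v => hr c v
    rw [this]
    exact ((ContinuousLinearMap.compL ℂ L L K).flip (σ c)).continuous.comp J.continuous

variable (C X Y) in
/-- The canonical map from the algebraic to the projective tensor product. -/
def toGamma : X ⊗[C] Y →ₗ[C] Gamma C X Y where
  toFun w := ((show GammaPre C X Y from w : GammaPre C X Y) : Completion (GammaPre C X Y))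
  map_add' v w := Completion.coe_add (α := GammaPre C X Y) v w
  map_smul' c w := Completion.coe_smul (X := GammaPre C X Y) c w

theorem norm_toGamma (w : X ⊗[C] Y) : ‖toGamma C X Y w‖ = gammaNorm w :=
  Completion.norm_coe (E := GammaPre C X Y) w

variable (ρ X Y) in
/-- The canonical map from the algebraic to the normal projective tensor product. -/
def toNu : X ⊗[C] Y →ₗ[C] Nu ρ X Y where
  toFun w := ((show NuPre ρ X Y from w : NuPre ρ X Y) : Completion (NuPre ρ X Y))
  map_add' v w := Completion.coe_add (α := NuPre ρ X Y) v w
  map_smul' c w := Completion.coe_smul (X := NuPre ρ X Y) c w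

theorem norm_toNu (w : X ⊗[C] Y) : ‖toNu ρ X Y w‖ = nuNorm ρ w :=
  Completion.norm_coe (E := NuPre ρ X Y) w

theorem nuNorm_le_gammaNorm (w : X ⊗[C] Y) : nuNorm ρ w ≤ gammaNorm w :=
  Real.sSup_le (fun _ => nuSet_le ρ) (gammaNorm_nonneg w)

theorem gamma_op_smul (c : C) (z : Gamma C X Y) : op c • z = c • z := op_smul_eq_smul c z

theorem nu_op_smul (c : C) (z : Nu ρ X Y) : op c • z = c • z := op_smul_eq_smul c z

theorem Gamma.induction {p : Gamma C X Y → Prop} (hc : IsClosed {z | p z})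
    (h : ∀ w, p (toGamma C X Y w)) (z : Gamma C X Y) : p z :=
  Completion.induction_on z hc h

theorem Nu.induction {p : Nu ρ X Y → Prop} (hc : IsClosed {z | p z})
    (h : ∀ w, p (toNu ρ X Y w)) (z : Nu ρ X Y) : p z :=
  Completion.induction_on z hc h

variable (ρ X Y) in
theorem exists_gamma_to_nu : ∃ ι : Gamma C X Y →L[ℂ] Nu ρ X Y,
    (∀ w, ι (toGamma C X Y w) = toNu ρ X Y w) ∧ ‖ι‖ ≤ 1 := by
  let f : GammaPre C X Y →ₗ[ℂ] Nu ρ X Y :=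
    { toFun := fun w => toNu ρ X Y (GammaPre.toTensor C X Y w)
      map_add' := fun v w => by rw [map_add, map_add]
      map_smul' := fun z w => by
        rw [map_smul]
        exact (Completion.toComplₗᵢ (𝕜 := ℂ) (E := NuPre ρ X Y)).map_smul z _ }
  obtain ⟨ι, h1, h2⟩ := exists_extension_completion f zero_le_one fun w => by
    rw [one_mul]
    exact (norm_toNu _).trans_le (nuNorm_le_gammaNorm _)
  exact ⟨ι, h1, h2⟩

/-- Bimodule maps on the projective tensor product are bounded in the norm `ν_C`. -/
theorem norm_le_mul_nuNorm {V : Type u} [NormedAddCommGroup V] [NormedSpace ℂ V] [CompleteSpace V]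
    [Module C V] [Module Cᵐᵒᵖ V] (hV : IsNormalRepresentable ρ V) (T : Gamma C X Y →L[ℂ] V)
    (hT : IsBimoduleMap C T) (w : X ⊗[C] Y) : ‖T (toGamma C X Y w)‖ ≤ ‖T‖ * nuNorm ρ w := by
  rcases (norm_nonneg T).eq_or_lt with h0 | h0
  · have h := T.le_opNorm (toGamma C X Y w)
    rwa [← h0, zero_mul] at h ⊢
  -- Scaling by ‖T‖⁻¹ makes the bilinear map (x, y) ↦ T(x ⊗ y) a contraction, so that it competes in
  -- the supremum defining ν_C.
  set z : ℂ := ((‖T‖⁻¹ : ℝ) : ℂ) with hz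
  have hzT : ∀ w, T (toGamma C X Y (z • w)) = z • T (toGamma C X Y w) := fun w => by
    rw [← map_smul]
    exact congrArg T ((Completion.toComplₗᵢ (𝕜 := ℂ) (E := GammaPre C X Y)).map_smul z w)
  have hzn : ∀ w, ‖T (toGamma C X Y (z • w))‖ = ‖T‖⁻¹ * ‖T (toGamma C X Y w)‖ := fun w => by
    rw [hzT, norm_smul, hz, Complex.norm_real, Real.norm_of_nonneg (inv_nonneg.2 h0.le)]
  let Ψ : X ⊗[C] Y →ₗ[C] V :=
    { toFun := fun w => T (toGamma C X Y (z • w))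
      map_add' := fun v w => by rw [smul_add, map_add, map_add]
      map_smul' := fun c w => by rw [smul_comm, map_smul, (hT c _).1, RingHom.id_apply] }
  have hΨ : ∀ w, Ψ w = T (toGamma C X Y (z • w)) := fun w => rfl
  have hmem : ‖Ψ w‖ ∈ nuSet ρ w := by
    refine ⟨V, inferInstance, inferInstance, inferInstance, inferInstance, inferInstance,
      (TensorProduct.mk C X Y).compr₂ Ψ, hV, fun c x y => ?_, fun x y => ?_, ?_⟩
    · change Ψ (x ⊗ₜ (op c • y)) = op c • Ψ (x ⊗ₜ y)
      rw [op_smul_eq_smul, TensorProduct.tmul_smul, hΨ, hΨ, smul_comm, map_smul, ← (hT c _).2,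
        gamma_op_smul]
    · change ‖Ψ (x ⊗ₜ y)‖ ≤ _
      rw [hΨ, hzn, inv_mul_le_iff₀ h0]
      refine (T.le_opNorm _).trans (mul_le_mul_of_nonneg_left ?_ h0.le)
      rw [norm_toGamma]
      exact gammaNorm_tmul_le x y
    · rw [TensorProduct.lift_mk_compr₂]
  have := le_csSup (nuSet_bddAbove ρ w) hmem
  rwa [hΨ, hzn, inv_mul_le_iff₀ h0] at this

/-- The factorization is the estimate `norm_le_mul_nuNorm` extended by continuity. Module identities
and uniqueness follow from density of the algebraic tensor product in both completions. -/
theorem isNormalPart_of_apply (hρ : IsVonNeumann ρ) (hX : IsRepresentable C X)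
    (hY : IsRepresentable C Y) {ι : Gamma C X Y →L[ℂ] Nu ρ X Y}
    (hι : ∀ w, ι (toGamma C X Y w) = toNu ρ X Y w) (hι1 : ‖ι‖ ≤ 1) : IsNormalPart ρ ι := by
  have := extremallyDisconnected_characterSpace hρ
  have hmod : ∀ (c : C) z, ι (c • z) = c • ι z := fun c z => by
    refine Gamma.induction (isClosed_eq (ι.continuous.comp (continuous_const_smul c))
      ((continuous_const_smul c).comp ι.continuous)) (fun w => ?_) z
    change ι (c • toGamma C X Y w) = c • ι (toGamma C X Y w)
    rw [← map_smul, hι, hι, map_smul]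
  refine ⟨inferInstance, isRepresentable_gamma hX hY, inferInstance,
    isNormalRepresentable_nu hρ hX hY, hι1,
    fun c z => ⟨hmod c z, by rw [gamma_op_smul, nu_op_smul, hmod]⟩, ?_⟩
  intro V _ _ _ _ _ hV T hT
  let f : NuPre ρ X Y →ₗ[ℂ] V :=
    { toFun := fun w => T (toGamma C X Y (NuPre.toTensor ρ X Y w))
      map_add' := fun v w => by rw [map_add, map_add, map_add]
      map_smul' := fun z w => by
        rw [RingHom.id_apply]
        exact (congrArg T ((Completion.toComplₗᵢ (𝕜 := ℂ) (E := GammaPre C X Y)).map_smul z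
          (NuPre.toTensor ρ X Y w))).trans (map_smul T z _) }
  obtain ⟨T', h1, h2⟩ := exists_extension_completion f (norm_nonneg T)
    fun w => norm_le_mul_nuNorm hV T hT _
  have hT' : ∀ w, T' (toNu ρ X Y w) = T (toGamma C X Y w) := h1
  refine ⟨T', fun c z => ⟨?_, ?_⟩, ?_, h2, fun S _ hS => ?_⟩
  · refine Nu.induction (isClosed_eq (T'.continuous.comp (continuous_const_smul c))
      ((hV.isRepresentable.continuous_smul c).1.comp T'.continuous)) (fun w => ?_) z
    change T' (c • toNu ρ X Y w) = c • T' (toNu ρ X Y w)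
    rw [← map_smul, hT', hT', map_smul, (hT c _).1]
  · rw [nu_op_smul]
    refine Nu.induction (isClosed_eq (T'.continuous.comp (continuous_const_smul c))
      ((hV.isRepresentable.continuous_smul c).2.comp T'.continuous)) (fun w => ?_) z
    change T' (c • toNu ρ X Y w) = op c • T' (toNu ρ X Y w)
    rw [← map_smul, hT', hT', map_smul, ← gamma_op_smul, (hT c _).2]
  · ext z
    refine Gamma.induction (isClosed_eq (T'.comp ι).continuous T.continuous) (fun w => ?_) z
    rw [ContinuousLinearMap.comp_apply, hι, hT']
  · ext z
    refine Nu.induction (isClosed_eq S.continuous T'.continuous) (fun w => ?_) z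
    rw [hT', ← hι, ← hS]
    rfl

/-- The family of all fibres of an element of the algebraic tensor product. -/
def fiberFamily (w : X ⊗[C] Y) :
    lp (fun t : characterSpace ℂ C => Gamma ℂ (Fiber t X) (Fiber t Y)) ∞ :=
  ⟨fun t => fiberEmb t w, memℓp_infty ⟨gammaNorm w, by
    rintro _ ⟨t, rfl⟩
    exact (norm_fiberEmb t w).trans_le (gammaNorm_fiberMap_le t w)⟩⟩

/-- On the algebraic tensor product isometry is the equality of ν_C with the essential norm;
completeness of the essential sum permits the extension. -/
theorem exists_isometry_essSum (hρ : IsVonNeumann ρ) (hX : IsRepresentable C X)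
    (hY : IsRepresentable C Y) :
    ∃ κ : Nu ρ X Y →ₗᵢ[ℂ]
        EssSum fun t : characterSpace ℂ C => Gamma ℂ (Fiber t X) (Fiber t Y),
      ∀ w, κ (toNu ρ X Y w) = EssSum.mk (fiberFamily w) := by
  let κ₀ : NuPre ρ X Y →ₗᵢ[ℂ]
      EssSum fun t : characterSpace ℂ C => Gamma ℂ (Fiber t X) (Fiber t Y) :=
    { toFun := fun w => EssSum.mk (fiberFamily (NuPre.toTensor ρ X Y w))
      map_add' := fun v w => by
        have : fiberFamily (NuPre.toTensor ρ X Y (v + w)) =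
            fiberFamily (NuPre.toTensor ρ X Y v) + fiberFamily (NuPre.toTensor ρ X Y w) :=
          lp.ext (funext fun t => map_add (fiberEmb t) _ _)
        rw [this]
        rfl
      map_smul' := fun z w => by
        have : fiberFamily (NuPre.toTensor ρ X Y (z • w)) =
            z • fiberFamily (NuPre.toTensor ρ X Y w) :=
          lp.ext (funext fun t => map_smul (fiberEmb t) _ _)
        rw [this]
        rfl
      norm_map' := fun w => by
        change ‖EssSum.mk (fiberFamily (NuPre.toTensor ρ X Y w))‖ = ‖w‖
        rw [NuPre.norm_eq w, nuNorm_eq_essNorm hρ hX hY, EssSum.norm_mk]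
        exact congrArg essup (funext fun t => norm_fiberEmb t _) }
  exact exists_isometry_completion κ₀

end NormalPart

end CentralModule

end

theorem mainTheorem7
    {C : Type u} [CommCStarAlgebra C]
    {H : Type u} [NormedAddCommGroup H] [InnerProductSpace ℂ H] [CompleteSpace H]
    (ρ : C →⋆ₐ[ℂ] (H →L[ℂ] H)) (hρ : IsVonNeumann ρ)
    {X : Type u} [NormedAddCommGroup X] [NormedSpace ℂ X] [CompleteSpace X]
    [Module C X] [IsScalarTower ℂ C X] [IsBoundedSMul C X]
    [Module Cᵐᵒᵖ X] [IsCentralScalar C X] (hX : IsNormalRepresentable ρ X)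
    {Y : Type u} [NormedAddCommGroup Y] [NormedSpace ℂ Y] [CompleteSpace Y]
    [Module C Y] [IsScalarTower ℂ C Y] [IsBoundedSMul C Y]
    [Module Cᵐᵒᵖ Y] [IsCentralScalar C Y] (hY : IsNormalRepresentable ρ Y) :
    ((∃ ι : Gamma C X Y →L[ℂ] Nu ρ X Y,
        (∀ x y, ι (Gamma.tmul C x y) = Nu.tmul ρ x y) ∧ IsNormalPart ρ ι) ∧
      ∃ κ : Nu ρ X Y →ₗᵢ[ℂ]
          EssSum fun t : WeakDual.characterSpace ℂ C => Gamma ℂ (Fiber t X) (Fiber t Y),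
        ∀ x y, κ (Nu.tmul ρ x y) = EssSum.mk (fiberTensor x y)) ∧
    (∀ (n : ℕ) (x : Fin n → X) (y : Fin n → Y),
      IsLUB {r : ℝ | ∃ θ : X →ₗ[C] Y →ₗ[C] C, (∀ a b, ‖θ a b‖ ≤ ‖a‖ * ‖b‖) ∧
          r = ‖∑ j, θ (x j) (y j)‖}
        (nuNorm ρ (∑ j, x j ⊗ₜ[C] y j))) ∧
    (∀ (n : ℕ) (x : Fin n → X) (y : Fin n → Y),
      IsLUB {r : ℝ | ∃ θ : X →ₗ[ℂ] Y →ₗ[ℂ] ℂ, (∀ a b, ‖θ a b‖ ≤ ‖a‖ * ‖b‖) ∧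
          (∀ (c : C) a b, θ (op c • a) b = θ a (c • b)) ∧
          (∀ a b, Continuous[weakStar ρ, inferInstance] fun c : C => θ a (c • b)) ∧
          r = ‖∑ j, θ (x j) (y j)‖}
        (nuNorm ρ (∑ j, x j ⊗ₜ[C] y j))) := by
  have hX' := hX.isRepresentable
  have hY' := hY.isRepresentable
  obtain ⟨ι, hι, hι1⟩ := exists_gamma_to_nu ρ X Y
  obtain ⟨κ, hκ⟩ := exists_isometry_essSum hρ hX' hY'
  exact ⟨⟨⟨ι, fun x y => hι (x ⊗ₜ y), isNormalPart_of_apply hρ hX' hY' hι hι1⟩,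
    κ, fun x y => hκ (x ⊗ₜ y)⟩, fun n x y => isLUB_nuNorm_module hρ hX' hY' x y,
    fun n x y => isLUB_nuNorm_normal hρ hX' hY' x y⟩
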